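/- **Setting.** Let $q\ge 2$, let $\Omega$ be an open neighborhood of $0$ in $\mathbb R^m$, and let $Y_{j\nu}$ ($1\le j\le N$, $1\le\nu\le q$) be linear differential operators of finite order on $\Omega$ with smooth complex-valued coefficients. Write $\|\cdot\|$ for the $L^2$ norm on $\Omega$. For a $q$-tuple $\varphi=(\varphi_1,\dots,\varphi_q)$ of smooth complex-valued functions with compact support in $\Omega$ put $$Q(\varphi,\varphi)=\sum_{\nu=1}^q\|\varphi_\nu\|^2+\sum_{j=1}^N\sum_{\nu=1}^q\|Y_{j\nu}\varphi_\nu\|^2 .$$ For an open set $U\subset\Omega$, an expression $\psi=\psi(\varphi)$ is *estimable on $U$* if there is a constant $C>0$ with $\|\psi(\varphi)\|^2\le C\,Q(\varphi,\varphi)$ for all $q$-tuples $\varphi$ of smooth complex-valued functions with compact support in $U$; a vector-valued expression is estimable if each of its components is. Let $\Lambda^{\varepsilon}=(1-\sum_{i=1}^m\partial_i^2)^{\varepsilon/2}$ on $\mathbb R^m$, defined by the Fourier transform. - The germ at $0$ of a smooth complex-valued function $\alpha$ is a *scalar multiplier of order $\ge\varepsilon$* if there is an open neighborhood $U\subset\Omega$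 of $0$ on which $\alpha$ is smooth such that $\Lambda^\varepsilon(\alpha\varphi_\nu)$ is estimable on $U$ for $1\le\nu\le q$. - The germ at $0$ of a $q$-tuple $\vec a=(a_1,\dots,a_q)$ of smooth complex-valued functions is a *vector multiplier of order $\ge\varepsilon$* if there is an open neighborhood $U\subset\Omega$ of $0$ on which $\vec a$ is smooth such that $\Lambda^\varepsilon\big(\sum_{\nu}a_\nu\varphi_\nu\big)$ is estimable on $U$. - A $q\times q$ matrix of smooth function germs at $0$ is a *matrix multiplier of order $\ge\varepsilon$* if each of its rows is a vector multiplier of order $\ge\varepsilon$. **Theorem.** Let $X_1,\dots,X_q$ be first-order linear differential operators on $\Omega$ with smooth complex-valued coefficients, with adjoints $X_1^*,\dots,X_q^*$ for the $L^2$ inner product on $\Omega$, such that $X_j^*\varphi=(X_j^*\varphi_1,\dots,X_j^*\varphi_q)$ is estimable on $\Omega$ for $1\le j\le q$. Let $\Gamma_{k\ell}$ ($1\le k,\ell\le q$) be smooth complex-valued functions on $\Omega$ such that $\sum_{k,\ell}\Gamma_{k\ell}X_k\varphi_\ell$ is estimable on $\Omega$. Let $0<\varepsilon_1,\varepsilon_2\le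 1$. Let $\mathbf a=(a_{jk})$ be a matrix multiplier of order $\ge\varepsilon_1$, let $\alpha$ be a scalar multiplier of order $\ge\varepsilon_2$, and let $A=(A_{jk})$ be a $q\times q$ matrix of smooth complex-valued function germs at $0$ with $\sum_{\ell}A_{j\ell}a_{\ell k}=\alpha\,\delta_{jk}$ for $1\le j,k\le q$. Then, with $$b_j=\sum_{p,\ell,k=1}^q\Gamma_{pk}A_{k\ell}\,(X_pa_{\ell j}),\qquad 1\le j\le q,$$ $\vec b=(b_1,\dots,b_q)$ is a vector multiplier of order $\ge\tfrac12\min(\varepsilon_1,\varepsilon_2)$. In particular: (i) If $\mathbf a$ is a matrix multiplier of order $\ge\varepsilon_1$ and $c_j=\sum_{p,\ell,k=1}^q\Gamma_{pk}\,\mathrm{adj}(\mathbf a)_{k\ell}\,(X_pa_{\ell j})$, where $\mathrm{adj}(\mathbf a)$ is the adjugate matrix of $\mathbf a$, then $\vec c=(c_1,\dots,c_q)$ is a vector multiplier of order $\ge\tfrac{\varepsilon_1}{2}$. When $\Gamma_{k\ell}=\delta_{k\ell}$ on $\Omega$, this says that the $q$-tuple with components $\sum_{p,\ell}\mathrm{adj}(\mathbf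 a)_{p\ell}\,(X_pa_{\ell j})$ is a vector multiplier of order $\ge\tfrac{\varepsilon_1}{2}$. (ii) If $\alpha$ is a scalar multiplier of order $\ge\varepsilon_2$ and $d_j=\sum_{k=1}^q\Gamma_{kj}\,(X_k\alpha)$, then $\vec d=(d_1,\dots,d_q)$ is a vector multiplier of order $\ge\tfrac{\varepsilon_2}{2}$. -/

import Mathlib

open scoped ContDiff NNReal ENNReal FourierTransform ComplexConjugate
open MeasureTheory

noncomputable section

namespace Subelliptic

/-- `ℝᵐ` with its Euclidean norm and Lebesgue measure. -/
abbrev Space (m : ℕ) : Type := EuclideanSpace ℝ (Fin m)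

variable {m q N : ℕ}

/-- The partial derivative `∂f/∂xᵢ`. -/
def pderiv (i : Fin m) (f : Space m → ℂ) : Space m → ℂ :=
  fun x => fderiv ℝ f x (EuclideanSpace.single i 1)

/-- The iterated partial derivative `∂₀^(β 0) ⋯ ∂_(m-1)^(β (m-1)) f` of a multi-index `β`. -/
def multiDeriv (β : Fin m → ℕ) (f : Space m → ℂ) : Space m → ℂ :=
  (List.finRange m).foldr (fun i g => (pderiv i)^[β i] g) f

/-- A complex-valued smooth linear differential operator of arbitrary finite order on `Ω`:
`∑ c_β ∂^β`, a finite sum over multi-indices whose coefficients are smooth on `Ω`. -/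
structure DiffOp (Ω : Set (Space m)) where
  /-- the multi-indices that occur -/
  indices : Finset (Fin m → ℕ)
  /-- the coefficients -/
  coeff : (Fin m → ℕ) → Space m → ℂ
  smooth : ∀ β ∈ indices, ContDiffOn ℝ ∞ (coeff β) Ω

/-- The action of a differential operator on a function. -/
def DiffOp.apply {Ω : Set (Space m)} (P : DiffOp Ω) (f : Space m → ℂ) : Space m → ℂ :=
  fun x => ∑ β ∈ P.indices, P.coeff β x * multiDeriv β f x

/-- A complex-valued smooth first-order linear differential operator on `Ω`:
`∑ ξᵢ ∂ᵢ + ζ` with coefficients smooth on `Ω`. -/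
structure FirstOrderOp (Ω : Set (Space m)) where
  /-- the coefficients of the first-order part -/
  ξ : Fin m → Space m → ℂ
  /-- the term of order zero -/
  ζ : Space m → ℂ
  smooth_ξ : ∀ i, ContDiffOn ℝ ∞ (ξ i) Ω
  smooth_ζ : ContDiffOn ℝ ∞ ζ Ω

/-- The action `X f = ∑ ξᵢ ∂ᵢ f + ζ f`. -/
def FirstOrderOp.apply {Ω : Set (Space m)} (X : FirstOrderOp Ω) (f : Space m → ℂ) :
    Space m → ℂ :=
  fun x => ∑ i, X.ξ i x * pderiv i f x + X.ζ x * f x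

/-- The action of the adjoint operator with respect to the `L²` inner product,
`X* v = -∑ ∂ᵢ (conj ξᵢ · v) + conj ζ · v`. -/
def FirstOrderOp.adjoint {Ω : Set (Space m)} (X : FirstOrderOp Ω) (v : Space m → ℂ) :
    Space m → ℂ :=
  fun x => -∑ i, pderiv i (fun y => conj (X.ξ i y) * v y) x + conj (X.ζ x) * v x

/-- A smooth complex-valued test function with compact support in `U`. -/
def IsTest (U : Set (Space m)) (f : Space m → ℂ) : Prop :=
  ContDiff ℝ ∞ f ∧ HasCompactSupport f ∧ tsupport f ⊆ U

/-- `FirstOrderOp.adjoint` is the adjoint for the `L²` inner product on `Ω`. -/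
theorem FirstOrderOp.integral_apply_mul_conj {m : ℕ} {Ω : Set (Space m)} (hΩ : IsOpen Ω)
    (X : FirstOrderOp Ω) {u v : Space m → ℂ} (hu : IsTest Ω u) (hv : IsTest Ω v) :
    ∫ x in Ω, X.apply u x * conj (v x) = ∫ x in Ω, u x * conj (X.adjoint v x) := by
  obtain ⟨hu1, hu2, hu3⟩ := hu
  obtain ⟨hv1, hv2, hv3⟩ := hv
  have hext : ∀ c : Space m → ℂ, ContDiffOn ℝ ∞ c Ω → ContDiff ℝ ∞ (fun y => conj (c y) * v y) := by
    intro c hc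
    rw [contDiff_iff_contDiffAt]
    intro x
    by_cases hx : x ∈ Ω
    · have h1 := hc.contDiffAt (hΩ.mem_nhds hx)
      exact (Complex.conjCLE.contDiff.contDiffAt.comp x h1).mul hv1.contDiffAt
    · have h2 : v =ᶠ[nhds x] 0 := notMem_tsupport_iff_eventuallyEq.1 (fun h => hx (hv3 h))
      have h3 : (fun y => conj (c y) * v y) =ᶠ[nhds x] fun _ => 0 := by
        filter_upwards [h2] with y hy
        simp [hy]
      exact contDiffAt_const.congr_of_eventuallyEq h3
  have hd : ∀ (w : Space m → ℂ), ContDiff ℝ ∞ w → ∀ i, Continuous (pderiv i w) := by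
    intro w hw i
    exact (hw.continuous_fderiv (by simp)).clm_apply continuous_const
  have hpc : ∀ (w : Space m → ℂ) (x : Space m) (i : Fin m), DifferentiableAt ℝ w x →
      fderiv ℝ (fun y => conj (w y)) x (EuclideanSpace.single i 1) = conj (pderiv i w x) := by
    intro w x i hw
    have := (Complex.conjCLE.hasFDerivAt (x := w x)).comp x hw.hasFDerivAt
    change fderiv ℝ (⇑Complex.conjCLE ∘ w) x _ = _
    rw [this.fderiv]; simp [pderiv]
  have key : ∀ c i, ContDiffOn ℝ ∞ c Ω →
      ∫ x, u x * conj (pderiv i (fun y => conj (c y) * v y) x)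
        = - ∫ x, pderiv i u x * (c x * conj (v x)) := by
    intro c i hc
    have hw := hext c hc
    have hwd : Differentiable ℝ (fun y => conj (c y) * v y) := hw.differentiable (by simp)
    have hW : ContDiff ℝ ∞ (fun y => conj (conj (c y) * v y)) := Complex.conjCLE.contDiff.comp hw
    have := integral_mul_fderiv_eq_neg_fderiv_mul_of_integrable (μ := volume) (𝕜 := ℂ) (f := u)
      (g := fun y => conj (conj (c y) * v y)) (v := EuclideanSpace.single i (1:ℝ))
      (((hd u hu1 i).mul hW.continuous).integrable_of_hasCompactSupport
        ((hu2.fderiv_apply (𝕜 := ℝ) _).mul_right))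
      ((hu1.continuous.mul (hd _ hW i)).integrable_of_hasCompactSupport hu2.mul_right)
      ((hu1.continuous.mul hW.continuous).integrable_of_hasCompactSupport hu2.mul_right)
      (fun x _ => hu1.differentiable (by simp) x) (fun x _ => hW.differentiable (by simp) x)
    simp only [hpc _ _ _ (hwd _)] at this
    simpa [pderiv] using this
  have hu0 : ∀ x, x ∉ Ω → u x = 0 := fun x hx => image_eq_zero_of_notMem_tsupport (fun h => hx (hu3 h))
  have hv0 : ∀ x, x ∉ Ω → v x = 0 := fun x hx => image_eq_zero_of_notMem_tsupport (fun h => hx (hv3 h))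
  rw [setIntegral_eq_integral_of_forall_compl_eq_zero (fun x hx => by simp [hv0 x hx]),
    setIntegral_eq_integral_of_forall_compl_eq_zero (fun x hx => by simp [hu0 x hx])]
  have hi1 : ∀ i, Integrable (fun x => pderiv i u x * (X.ξ i x * conj (v x))) := fun i => by
    have hW : Continuous (fun y => conj (conj (X.ξ i y) * v y)) :=
      Complex.continuous_conj.comp (hext _ (X.smooth_ξ i)).continuous
    have := ((hd u hu1 i).mul hW).integrable_of_hasCompactSupport (μ := volume)
        ((hu2.fderiv_apply (𝕜 := ℝ) _).mul_right)
    refine this.congr (Filter.Eventually.of_forall fun x => ?_)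
    simp
  have hi2 : ∀ i, Integrable (fun x => u x * conj (pderiv i (fun y => conj (X.ξ i y) * v y) x)) :=
    fun i => (hu1.continuous.mul (Complex.continuous_conj.comp
      (hd _ (hext _ (X.smooth_ξ i)) i))).integrable_of_hasCompactSupport hu2.mul_right
  have hi3 : Integrable (fun x => u x * (X.ζ x * conj (v x))) := by
    have hW : Continuous (fun y => conj (conj (X.ζ y) * v y)) :=
      Complex.continuous_conj.comp (hext _ X.smooth_ζ).continuous
    have := (hu1.continuous.mul hW).integrable_of_hasCompactSupport (μ := volume) hu2.mul_right
    refine this.congr (Filter.Eventually.of_forall fun x => ?_)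
    simp
  have e1 : ∀ x, X.apply u x * conj (v x)
      = ∑ i, pderiv i u x * (X.ξ i x * conj (v x)) + u x * (X.ζ x * conj (v x)) := by
    intro x
    simp only [FirstOrderOp.apply, add_mul, Finset.sum_mul]
    congr 1
    · exact Finset.sum_congr rfl fun i _ => by ring
    · ring
  have e2 : ∀ x, u x * conj (X.adjoint v x)
      = -∑ i, u x * conj (pderiv i (fun y => conj (X.ξ i y) * v y) x)
        + u x * (X.ζ x * conj (v x)) := by
    intro x
    simp [FirstOrderOp.adjoint, mul_add, Finset.mul_sum]
  simp only [e1, e2]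
  rw [integral_add (integrable_finsetSum _ fun i _ => hi1 i) hi3,
    integral_add (f := fun x => -∑ i, u x * conj (pderiv i (fun y => conj (X.ξ i y) * v y) x))
      (integrable_finsetSum _ fun i _ => hi2 i).neg hi3, integral_neg,
    integral_finsetSum _ fun i _ => hi1 i, integral_finsetSum _ fun i _ => hi2 i]
  simp only [fun i => key (X.ξ i) i (X.smooth_ξ i), Finset.sum_neg_distrib, neg_neg]

/-- The square of the `L²` norm on `Ω`. -/
def normSq (Ω : Set (Space m)) (f : Space m → ℂ) : ℝ≥0∞ :=
  eLpNorm f 2 (volume.restrict Ω) ^ 2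

/-- `Q(φ,φ) = ‖φ‖² + ∑_{j,ν} ‖Y_{jν} φ_ν‖²`. -/
def energy (Ω : Set (Space m)) (Y : Fin N → Fin q → DiffOp Ω) (φ : Fin q → Space m → ℂ) :
    ℝ≥0∞ :=
  ∑ ν, normSq Ω (φ ν) + ∑ j, ∑ ν, normSq Ω ((Y j ν).apply (φ ν))

/-- The expression `ψ` in the `q`-tuple `φ` is estimable on `U`: there is a constant `C` with
`‖ψ(φ)‖² ≤ C Q(φ,φ)` for all `q`-tuples `φ` of test functions on `U`. -/
def Estimable (Ω : Set (Space m)) (Y : Fin N → Fin q → DiffOp Ω) (U : Set (Space m))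
    (ψ : (Fin q → Space m → ℂ) → Space m → ℂ) : Prop :=
  ∃ C : ℝ≥0, 0 < C ∧ ∀ φ : Fin q → Space m → ℂ, (∀ ν, IsTest U (φ ν)) →
    normSq Ω (ψ φ) ≤ C * energy Ω Y φ

/-- `Λ^s = (1 - ∑ ∂ᵢ²)^(s/2)` on `ℝᵐ`, through the Fourier transform. The Fourier transform has
the kernel `exp (-2πi⟨x, ξ⟩)`, so that `-∑ ∂ᵢ²` has the symbol `(2π‖ξ‖)²`. -/
def Lam (s : ℝ) (f : Space m → ℂ) : Space m → ℂ :=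
  𝓕⁻ (fun ξ : Space m => (((1 + (2 * Real.pi * ‖ξ‖) ^ 2) ^ (s / 2) : ℝ) : ℂ) * 𝓕 f ξ)

/-- `f` represents the germ at `0` of a smooth function. -/
def SmoothGerm (f : Space m → ℂ) : Prop :=
  ∃ U : Set (Space m), IsOpen U ∧ 0 ∈ U ∧ ContDiffOn ℝ ∞ f U

/-- `α` is a scalar multiplier at `0` with order of subellipticity `≥ ε`. -/
def IsScalarMultiplier (Ω : Set (Space m)) (Y : Fin N → Fin q → DiffOp Ω) (ε : ℝ)
    (α : Space m → ℂ) : Prop :=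
  ∃ U : Set (Space m), IsOpen U ∧ 0 ∈ U ∧ U ⊆ Ω ∧ ContDiffOn ℝ ∞ α U ∧
    ∀ ν, Estimable Ω Y U (fun φ => Lam ε (fun x => α x * φ ν x))

/-- `a = (a₁, …, a_q)` is a vector multiplier at `0` with order of subellipticity `≥ ε`. -/
def IsVectorMultiplier (Ω : Set (Space m)) (Y : Fin N → Fin q → DiffOp Ω) (ε : ℝ)
    (a : Fin q → Space m → ℂ) : Prop :=
  ∃ U : Set (Space m), IsOpen U ∧ 0 ∈ U ∧ U ⊆ Ω ∧ (∀ ν, ContDiffOn ℝ ∞ (a ν) U) ∧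
    Estimable Ω Y U (fun φ => Lam ε (fun x => ∑ ν, a ν x * φ ν x))

/-- A matrix multiplier at `0` with order of subellipticity `≥ ε`: every row is a vector
multiplier at `0` with order of subellipticity `≥ ε`. -/
def IsMatrixMultiplier (Ω : Set (Space m)) (Y : Fin N → Fin q → DiffOp Ω) (ε : ℝ)
    (a : Space m → Matrix (Fin q) (Fin q) ℂ) : Prop :=
  ∀ j, IsVectorMultiplier Ω Y ε (fun k x => a x j k)

end Subelliptic

end

noncomputable section

namespace Subelliptic

open scoped SchwartzMap LineDeriv
open SchwartzMap

variable {m : ℕ}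

/-! Put ε = min(ε₁, ε₂), u_l = ∑ a_lj φ_j, ψ = ∑ b_j φ_j and F = ΓA, and let ζ_p be the zeroth-order
term of X_p. The Leibniz rule and A a = α I give (`sum_identity`) ψ = ∑ F_pl X_p u_l - α ∑ Γ_kl X_k
φ_l + ∑ F_pl ζ_p u_l. Pair this with Λ^ε ψ, using ‖Λ^(ε/2) ψ‖² = ⟨ψ, Λ^ε ψ⟩; this is why half of the
order survives. In the first sum Λ^ε moves to u_l and F_pl X_p moves to ψ as an adjoint: Λ^ε u_l is
estimable because `a` is a matrix multiplier, and (F_pl X_p)* ψ because every X_p* φ_j is. In the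
second term ∑ Γ_kl X_k φ_l is estimable, and so is α Λ^ε ψ, because α is a scalar multiplier. The
third term only needs Λ^ε u_l. `Bounded.lam_half` is this argument in abstract form, and
`Bounded.lam_half_pair` applies it.

The errors are commutators: [Λ^ε, f] has order ε - 1 ≤ 0 (`exists_l2norm_commutator_le`), so [Λ^ε,
X] has order ε (`exists_l2norm_commutator_opS_le`). For 0 ≤ ε ≤ 1 this needs no symbol calculus,
only an elementary inequality for ⟨ξ⟩^ε and Young's inequality on the Fourier side.

Estimates are given in L² of Ω while Λ^ε is nonlocal. Near 0 all coefficients are therefore replaced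
by Schwartz functions (`exists_schwartz_cutoff`), and a cutoff carries bounds for Λ^ε from Ω to ℝᵐ
(`Bounded.lam_of_estimable`).

Case (i) takes A = adj a and α = det a, a scalar multiplier by
`IsMatrixMultiplier.isScalarMultiplier`; case (ii) takes a = α I and A = I. -/

/-- Complex-valued Schwartz functions on `ℝᵐ`. -/
abbrev Schwartz (m : ℕ) : Type := 𝓢(Space m, ℂ)

/-! ### The Japanese bracket and the operators Λ^s -/

/-- The Japanese bracket `⟨ξ⟩ = (1 + (2π‖ξ‖)²)^(1/2)`. -/
def bracket (ξ : Space m) : ℝ := Real.sqrt (1 + (2 * Real.pi * ‖ξ‖) ^ 2)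

theorem bracket_pos (ξ : Space m) : 0 < bracket ξ := by
  unfold bracket; positivity

theorem one_le_bracket (ξ : Space m) : 1 ≤ bracket ξ := by
  unfold bracket
  rw [Real.one_le_sqrt]
  nlinarith [sq_nonneg (2 * Real.pi * ‖ξ‖)]

theorem bracket_rpow (s : ℝ) (ξ : Space m) :
    (1 + (2 * Real.pi * ‖ξ‖) ^ 2) ^ (s / 2) = bracket ξ ^ s := by
  rw [bracket, Real.sqrt_eq_rpow, ← Real.rpow_mul (by positivity)]
  congr 1; ring

theorem norm_le_bracket (ξ : Space m) : 2 * Real.pi * ‖ξ‖ ≤ bracket ξ := by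
  unfold bracket
  apply Real.le_sqrt_of_sq_le
  linarith

theorem bracket_le (ξ : Space m) : bracket ξ ≤ 1 + 2 * Real.pi * ‖ξ‖ := by
  unfold bracket
  rw [Real.sqrt_le_left (by positivity)]
  nlinarith [norm_nonneg ξ, Real.pi_pos, mul_nonneg Real.pi_pos.le (norm_nonneg ξ)]

theorem continuous_bracket : Continuous (bracket : Space m → ℝ) := by
  unfold bracket; fun_prop

/-- This plays the role of Peetre's inequality. After squaring, the cross term of the triangle
inequality is dominated by ⟨η⟩⟨ξ - η⟩. -/
theorem bracket_le_add (ξ η : Space m) : bracket ξ ≤ bracket η + bracket (ξ - η) := by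
  have h1 : ‖ξ‖ ≤ ‖η‖ + ‖ξ - η‖ := by
    simpa using norm_add_le η (ξ - η)
  have h2 := norm_le_bracket (ξ - η)
  have h3 := norm_le_bracket η
  have h4 := bracket_pos η
  have h5 : bracket η ^ 2 = 1 + (2 * Real.pi * ‖η‖) ^ 2 := Real.sq_sqrt (by positivity)
  have h6 : bracket (ξ - η) ^ 2 = 1 + (2 * Real.pi * ‖ξ - η‖) ^ 2 := Real.sq_sqrt (by positivity)
  have h8 : 2 * Real.pi * ‖ξ‖ ≤ 2 * Real.pi * ‖η‖ + 2 * Real.pi * ‖ξ - η‖ := by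
    have := mul_le_mul_of_nonneg_left h1 (by positivity : 0 ≤ 2 * Real.pi)
    linarith
  have h9 : (2 * Real.pi * ‖ξ‖) ^ 2 ≤ (2 * Real.pi * ‖η‖ + 2 * Real.pi * ‖ξ - η‖) ^ 2 :=
    pow_le_pow_left₀ (by positivity) h8 2
  have h7 : (2 * Real.pi * ‖η‖) * (2 * Real.pi * ‖ξ - η‖) ≤ bracket η * bracket (ξ - η) :=
    mul_le_mul h3 h2 (by positivity) h4.le
  nth_rw 1 [bracket]
  rw [Real.sqrt_le_left (by linarith [bracket_pos (ξ - η)])]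
  nlinarith

theorem bracket_neg (ξ : Space m) : bracket (-ξ) = bracket ξ := by simp [bracket]

/-- The elementary inequality behind the commutator estimate: `r^ε t^(1-ε)` lies between
`r` and `t`. -/
theorem abs_rpow_sub_rpow_le {r t ε : ℝ} (hr : 0 < r) (ht : 0 < t) (h0 : 0 ≤ ε) (h1 : ε ≤ 1) :
    |r ^ ε - t ^ ε| ≤ |r - t| * t ^ (ε - 1) := by
  have e1 : t ^ ε = t * t ^ (ε - 1) := by
    rw [Real.rpow_sub_one ht.ne']; field_simp
  have e2 : r ^ ε = (r ^ ε * t ^ (1 - ε)) * t ^ (ε - 1) := by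
    rw [mul_assoc, ← Real.rpow_add ht]; simp
  have ht' : 0 < t ^ (ε - 1) := Real.rpow_pos_of_pos ht _
  -- With the factor t^(ε-1) removed, the claim is |r^ε t^(1-ε) - t| ≤ |r - t|.
  rw [e1, e2, ← sub_mul, abs_mul, abs_of_pos ht']
  refine mul_le_mul_of_nonneg_right ?_ ht'.le
  have e3 : t = t ^ ε * t ^ (1 - ε) := by rw [← Real.rpow_add ht]; simp
  have e4 : r = r ^ ε * r ^ (1 - ε) := by rw [← Real.rpow_add hr]; simp
  have hp1 := Real.rpow_pos_of_pos ht (1 - ε)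
  have hp2 := Real.rpow_pos_of_pos hr ε
  rcases le_total r t with h | h
  · have a1 : r ^ ε ≤ t ^ ε := Real.rpow_le_rpow hr.le h h0
    have a2 : r ^ (1 - ε) ≤ t ^ (1 - ε) := Real.rpow_le_rpow hr.le h (by linarith)
    rw [abs_of_nonpos (by nlinarith), abs_of_nonpos (by linarith)]
    nlinarith
  · have a1 : t ^ ε ≤ r ^ ε := Real.rpow_le_rpow ht.le h h0
    have a2 : t ^ (1 - ε) ≤ r ^ (1 - ε) := Real.rpow_le_rpow ht.le h (by linarith)
    rw [abs_of_nonneg (by nlinarith), abs_of_nonneg (by linarith)]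
    nlinarith

/-- The symbol difference gains ⟨η⟩^(ε-1) at the price of one power of ⟨ξ - η⟩, which the rapid
decay of the Fourier transform of a Schwartz coefficient absorbs. -/
theorem abs_bracket_rpow_sub_le {ε : ℝ} (h0 : 0 ≤ ε) (h1 : ε ≤ 1) (ξ η : Space m) :
    |bracket ξ ^ ε - bracket η ^ ε| ≤ bracket (ξ - η) * bracket η ^ (ε - 1) := by
  refine (abs_rpow_sub_rpow_le (bracket_pos ξ) (bracket_pos η) h0 h1).trans ?_
  refine mul_le_mul_of_nonneg_right ?_ (Real.rpow_nonneg (bracket_pos η).le _)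
  rw [abs_le]
  have a1 := bracket_le_add ξ η
  have a2 := bracket_le_add η ξ
  rw [← neg_sub, bracket_neg] at a2
  constructor <;> linarith

/-- The symbol of `Λ^s`. -/
def symbol (s : ℝ) (ξ : Space m) : ℂ := ((bracket ξ ^ s : ℝ) : ℂ)

theorem hasTemperateGrowth_symbol (s : ℝ) : (symbol s : Space m → ℂ).HasTemperateGrowth := by
  have h1 : (fun ξ : Space m => (1 + ‖(2 * Real.pi) • ξ‖ ^ 2) ^ (s / 2)).HasTemperateGrowth :=
    (Function.hasTemperateGrowth_one_add_norm_sq_rpow (H := Space m) (s / 2)).comp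
      (((2 * Real.pi) • ContinuousLinearMap.id ℝ (Space m)).hasTemperateGrowth)
  have h2 := Function.HasTemperateGrowth.comp Function.Complex.hasTemperateGrowth_ofReal h1
  have h3 : (symbol s : Space m → ℂ)
      = Complex.ofReal ∘ fun ξ => (1 + ‖(2 * Real.pi) • ξ‖ ^ 2) ^ (s / 2) := by
    funext ξ
    rw [symbol, Function.comp_apply, ← bracket_rpow, norm_smul,
      Real.norm_of_nonneg (by positivity : 0 ≤ 2 * Real.pi)]
  rw [h3]; exact h2

/-- `Λ^s` on Schwartz functions. -/
def lam (s : ℝ) : Schwartz m →L[ℂ] Schwartz m := fourierMultiplierCLM ℂ (symbol s)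

theorem fourier_lam (s : ℝ) (f : Schwartz m) (ξ : Space m) :
    𝓕 (lam s f) ξ = symbol s ξ * 𝓕 f ξ := by
  simp [lam, fourierMultiplierCLM_apply, smulLeftCLM_apply_apply (hasTemperateGrowth_symbol s)]

/-- Links the pointwise formula in the definition of multipliers to an operator that preserves the
Schwartz space. -/
theorem coe_lam (s : ℝ) (f : Schwartz m) : ⇑(lam s f) = Lam s f := by
  have h : lam s f = 𝓕⁻ (smulLeftCLM ℂ (symbol s) (𝓕 f)) := rfl
  rw [h, fourierInv_coe, Lam]
  congr 1
  ext ξ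
  rw [smulLeftCLM_apply_apply (hasTemperateGrowth_symbol s), fourier_coe, bracket_rpow]
  rfl

theorem fourier_injective {f g : Schwartz m} (h : ∀ ξ, 𝓕 f ξ = 𝓕 g ξ) : f = g := by
  have h1 : 𝓕 f = 𝓕 g := SchwartzMap.ext h
  have h2 : (𝓕⁻ (𝓕 f) : Schwartz m) = 𝓕⁻ (𝓕 g) := by rw [h1]
  simpa using h2

theorem lam_lam (s t : ℝ) (f : Schwartz m) : lam s (lam t f) = lam (s + t) f := by
  refine fourier_injective fun ξ => ?_
  simp only [fourier_lam, symbol, Real.rpow_add (bracket_pos ξ)]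
  push_cast; ring

theorem lam_zero (f : Schwartz m) : lam 0 f = f :=
  fourier_injective fun ξ => by simp [fourier_lam, symbol]

/-! ### L² pairing and Plancherel -/

/-- The `L²` norm of a Schwartz function. -/
def l2norm (f : Schwartz m) : ℝ := ‖f.toLp 2 (volume : Measure (Space m))‖

/-- The `L²` inner product of two Schwartz functions. -/
def l2inner (f g : Schwartz m) : ℂ := ∫ x, conj (f x) * g x

theorem l2inner_eq (f g : Schwartz m) :
    l2inner f g = inner ℂ (f.toLp 2 (volume : Measure (Space m))) (g.toLp 2 volume) := by
  rw [inner_toL2_toL2_eq f g volume]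
  simp [l2inner, mul_comm]

theorem toLp_add (f g : Schwartz m) :
    (f + g).toLp 2 (volume : Measure (Space m)) = f.toLp 2 volume + g.toLp 2 volume :=
  (toLpCLM ℂ ℂ 2 (volume : Measure (Space m))).map_add f g

theorem toLp_smul (c : ℂ) (f : Schwartz m) :
    (c • f).toLp 2 (volume : Measure (Space m)) = c • f.toLp 2 volume :=
  (toLpCLM ℂ ℂ 2 (volume : Measure (Space m))).map_smul c f

theorem l2norm_nonneg (f : Schwartz m) : 0 ≤ l2norm f := norm_nonneg _

theorem l2norm_add_le (f g : Schwartz m) : l2norm (f + g) ≤ l2norm f + l2norm g := by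
  simp only [l2norm, toLp_add]; exact norm_add_le _ _

theorem l2norm_smul (c : ℂ) (f : Schwartz m) : l2norm (c • f) = ‖c‖ * l2norm f := by
  simp only [l2norm, toLp_smul]; exact norm_smul _ _

theorem l2norm_neg (f : Schwartz m) : l2norm (-f) = l2norm f := by
  simpa using l2norm_smul (-1) f

theorem l2norm_zero : l2norm (0 : Schwartz m) = 0 := by
  simpa using l2norm_smul 0 (0 : Schwartz m)

theorem norm_l2inner_le (f g : Schwartz m) : ‖l2inner f g‖ ≤ l2norm f * l2norm g := by
  rw [l2inner_eq]; exact norm_inner_le_norm _ _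

theorem l2inner_self (f : Schwartz m) : l2inner f f = ((l2norm f ^ 2 : ℝ) : ℂ) := by
  rw [l2inner_eq, inner_self_eq_norm_sq_to_K]; simp [l2norm]

theorem l2inner_add_right (f g h : Schwartz m) :
    l2inner f (g + h) = l2inner f g + l2inner f h := by
  simp only [l2inner_eq, toLp_add, inner_add_right]

theorem l2inner_add_left (f g h : Schwartz m) :
    l2inner (f + g) h = l2inner f h + l2inner g h := by
  simp only [l2inner_eq, toLp_add, inner_add_left]

theorem l2inner_neg_left (f g : Schwartz m) : l2inner (-f) g = -l2inner f g := by
  simp [l2inner, integral_neg]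

theorem l2inner_zero_left (g : Schwartz m) : l2inner 0 g = 0 := by simp [l2inner]

theorem l2inner_sum_left {ι : Type*} (s : Finset ι) (f : ι → Schwartz m) (g : Schwartz m) :
    l2inner (∑ i ∈ s, f i) g = ∑ i ∈ s, l2inner (f i) g := by
  classical
  induction s using Finset.induction_on with
  | empty => simp [l2inner_zero_left]
  | insert a s ha ih => rw [Finset.sum_insert ha, Finset.sum_insert ha, l2inner_add_left, ih]

theorem l2inner_fourier (f g : Schwartz m) : l2inner (𝓕 f) (𝓕 g) = l2inner f g := by
  simp only [l2inner_eq]; exact inner_fourier_toL2_eq f g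

theorem l2norm_fourier (f : Schwartz m) : l2norm (𝓕 f) = l2norm f := norm_fourier_toL2_eq f

/-- By Plancherel, `lam s` is multiplication by a real function, hence symmetric. -/
theorem l2inner_lam (s : ℝ) (f g : Schwartz m) : l2inner (lam s f) g = l2inner f (lam s g) := by
  rw [← l2inner_fourier, ← l2inner_fourier f]
  refine integral_congr_ae (Filter.Eventually.of_forall fun ξ => ?_)
  simp only [fourier_lam, map_mul, symbol, Complex.conj_ofReal]
  ring

theorem l2norm_eq_toReal (f : Schwartz m) :
    l2norm f = (eLpNorm f 2 (volume : Measure (Space m))).toReal := by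
  rw [l2norm, SchwartzMap.norm_toLp]

theorem ofReal_l2norm (f : Schwartz m) :
    ENNReal.ofReal (l2norm f) = eLpNorm f 2 (volume : Measure (Space m)) := by
  rw [l2norm_eq_toReal, ENNReal.ofReal_toReal (f.eLpNorm_lt_top 2 volume).ne]

theorem eLpNorm_two_sq {μ : Measure (Space m)} (f : Space m → ℂ) :
    eLpNorm f 2 μ ^ 2 = ∫⁻ x, ‖f x‖ₑ ^ 2 ∂μ := by
  rw [eLpNorm_eq_lintegral_rpow_enorm_toReal (by norm_num) (by norm_num)]
  rw [← ENNReal.rpow_natCast, ← ENNReal.rpow_mul]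
  simp

theorem l2norm_le_of_norm_le {f g : Schwartz m} {C : ℝ} (h : ∀ x, ‖f x‖ ≤ C * ‖g x‖) :
    l2norm f ≤ C * l2norm g := by
  refine Lp.norm_le_mul_norm_of_ae_le_mul ?_
  filter_upwards [f.coeFn_toLp 2 volume, g.coeFn_toLp 2 volume] with x hf hg
  rw [hf, hg]; exact h x

theorem l2norm_le_of_fourier {f g : Schwartz m} {C : ℝ} (h : ∀ ξ, ‖𝓕 f ξ‖ ≤ C * ‖𝓕 g ξ‖) :
    l2norm f ≤ C * l2norm g := by
  rw [← l2norm_fourier f, ← l2norm_fourier g]; exact l2norm_le_of_norm_le h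

theorem norm_symbol (s : ℝ) (ξ : Space m) : ‖symbol s ξ‖ = bracket ξ ^ s := by
  rw [symbol, Complex.norm_real, Real.norm_of_nonneg (Real.rpow_nonneg (bracket_pos ξ).le _)]

theorem l2norm_lam_mono {s t : ℝ} (h : s ≤ t) (f : Schwartz m) :
    l2norm (lam s f) ≤ l2norm (lam t f) := by
  rw [← one_mul (l2norm (lam t f))]
  refine l2norm_le_of_fourier fun ξ => ?_
  rw [fourier_lam, fourier_lam, norm_mul, norm_mul, norm_symbol, norm_symbol, one_mul]
  gcongr
  exact one_le_bracket ξ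

theorem l2norm_lam_le {s : ℝ} (h : s ≤ 0) (f : Schwartz m) : l2norm (lam s f) ≤ l2norm f := by
  simpa [lam_zero] using l2norm_lam_mono h f

theorem l2norm_le_lam {s : ℝ} (h : 0 ≤ s) (f : Schwartz m) : l2norm f ≤ l2norm (lam s f) := by
  simpa [lam_zero] using l2norm_lam_mono h f

/-! ### Derivatives and products of Schwartz functions -/

/-- The partial derivative of a Schwartz function. -/
def partialD (i : Fin m) (f : Schwartz m) : Schwartz m := ∂_{EuclideanSpace.single i (1 : ℝ)} f

theorem coe_partialD (i : Fin m) (f : Schwartz m) : ⇑(partialD i f) = pderiv i f := by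
  ext x
  exact lineDerivOp_apply_eq_fderiv _ f x

theorem fourier_partialD (i : Fin m) (f : Schwartz m) (ξ : Space m) :
    𝓕 (partialD i f) ξ = 2 * Real.pi * Complex.I * ξ i * 𝓕 f ξ := by
  rw [partialD, fourier_lineDerivOp_eq]
  have : (fun x : Space m => inner ℝ x (EuclideanSpace.single i (1 : ℝ))).HasTemperateGrowth := by
    fun_prop
  rw [smul_apply, smulLeftCLM_apply_apply this]
  simp [EuclideanSpace.inner_single_right, mul_assoc]

theorem lam_partialD (s : ℝ) (i : Fin m) (f : Schwartz m) :
    lam s (partialD i f) = partialD i (lam s f) :=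
  fourier_injective fun ξ => by simp only [fourier_lam, fourier_partialD]; ring

/-- A derivative costs one order, as |2πξᵢ| ≤ ⟨ξ⟩. This offsets the order gained by commuting Λ^s
with a coefficient. -/
theorem l2norm_lam_partialD_le (s : ℝ) (i : Fin m) (f : Schwartz m) :
    l2norm (lam (s - 1) (partialD i f)) ≤ l2norm (lam s f) := by
  rw [← one_mul (l2norm (lam s f))]
  refine l2norm_le_of_fourier fun ξ => ?_
  rw [fourier_lam, fourier_lam, fourier_partialD, norm_mul, norm_mul, norm_symbol,
    one_mul, Real.rpow_sub_one (bracket_pos ξ).ne']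
  simp only [norm_mul, norm_symbol, Complex.norm_I, Complex.norm_real, Complex.norm_ofNat, mul_one,
    Real.norm_of_nonneg Real.pi_pos.le, norm_mul]
  have h1 : 2 * Real.pi * ‖ξ i‖ ≤ bracket ξ :=
    (mul_le_mul_of_nonneg_left (PiLp.norm_apply_le ξ i) (by positivity)).trans (norm_le_bracket ξ)
  have h2 := Real.rpow_nonneg (bracket_pos ξ).le s
  rw [div_mul_eq_mul_div, div_le_iff₀ (bracket_pos ξ)]
  calc bracket ξ ^ s * (2 * Real.pi * ‖ξ i‖ * ‖𝓕 f ξ‖)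
      = (bracket ξ ^ s * ‖𝓕 f ξ‖) * (2 * Real.pi * ‖ξ i‖) := by ring
    _ ≤ _ := mul_le_mul_of_nonneg_left h1 (by positivity)

theorem l2inner_partialD (i : Fin m) (f g : Schwartz m) :
    l2inner (partialD i f) g = -l2inner f (partialD i g) := by
  rw [← l2inner_fourier, ← l2inner_fourier f, l2inner, l2inner, ← integral_neg]
  refine integral_congr_ae (Filter.Eventually.of_forall fun ξ => ?_)
  simp only [fourier_partialD, map_mul, Complex.conj_I, Complex.conj_ofReal, map_ofNat]
  ring

/-- The product of two Schwartz functions. -/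
def mulS (f g : Schwartz m) : Schwartz m := pairing (ContinuousLinearMap.mul ℂ ℂ) f g

@[simp]
theorem mulS_apply (f g : Schwartz m) (x : Space m) : mulS f g x = f x * g x := rfl

/-- The complex conjugate of a Schwartz function. -/
def conjS (f : Schwartz m) : Schwartz m :=
  postcompCLM (𝕜 := ℝ) (Complex.conjCLE : ℂ →L[ℝ] ℂ) f

@[simp]
theorem conjS_apply (f : Schwartz m) (x : Space m) : conjS f x = conj (f x) := rfl

theorem mulS_add (f g h : Schwartz m) : mulS f (g + h) = mulS f g + mulS f h := by
  ext x; simp [mul_add]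

theorem mulS_sum {ι : Type*} (s : Finset ι) (f : Schwartz m) (g : ι → Schwartz m) :
    mulS f (∑ i ∈ s, g i) = ∑ i ∈ s, mulS f (g i) :=
  map_sum (pairing (ContinuousLinearMap.mul ℂ ℂ) f) g s

theorem l2inner_mulS (f g h : Schwartz m) :
    l2inner (mulS f g) h = l2inner g (mulS (conjS f) h) := by
  refine integral_congr_ae (Filter.Eventually.of_forall fun x => ?_)
  simp only [mulS_apply, conjS_apply, map_mul]; ring

theorem exists_l2norm_mulS_le (f : Schwartz m) :
    ∃ C : ℝ, 0 ≤ C ∧ ∀ u, l2norm (mulS f u) ≤ C * l2norm u := by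
  refine ⟨SchwartzMap.seminorm ℝ 0 0 f, apply_nonneg _ _, fun u => l2norm_le_of_norm_le fun x => ?_⟩
  rw [mulS_apply, norm_mul]
  gcongr
  exact norm_le_seminorm ℝ f x

theorem partialD_mulS (i : Fin m) (f g : Schwartz m) :
    partialD i (mulS f g) = mulS (partialD i f) g + mulS f (partialD i g) := by
  ext x
  have h : ∀ h : Schwartz m, partialD i h x = fderiv ℝ h x (EuclideanSpace.single i 1) :=
    fun h => lineDerivOp_apply_eq_fderiv _ h x
  simp only [add_apply, mulS_apply, h]
  have : (⇑(mulS f g)) = fun x => f x * g x := rfl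
  rw [this, fderiv_fun_mul f.differentiableAt g.differentiableAt]
  simp; ring

/-! ### Young's inequality and the commutator of Λ^ε with a multiplication -/

/-- Young's inequality `L¹ * L² ⊆ L²`. -/
theorem lintegral_sq_convolution_le {k v : Space m → ℝ≥0∞} (hk : Measurable k) (hv : Measurable v) :
    ∫⁻ ξ, (∫⁻ η, k (ξ - η) * v η) ^ 2 ≤ (∫⁻ ζ, k ζ) ^ 2 * ∫⁻ η, v η ^ 2 := by
  have hk' : ∀ ξ, ∫⁻ η, k (ξ - η) = ∫⁻ ζ, k ζ := fun ξ => lintegral_sub_left_eq_self k ξ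
  have hmeas : ∀ ξ, Measurable fun η => k (ξ - η) := fun ξ =>
    hk.comp (measurable_const.sub measurable_id)
  -- Cauchy–Schwarz with k = k^(1/2) · k^(1/2); integrating in ξ and exchanging the integrals then
  -- finishes.
  have h1 : ∀ ξ, (∫⁻ η, k (ξ - η) * v η) ^ 2
      ≤ (∫⁻ ζ, k ζ) * ∫⁻ η, k (ξ - η) * v η ^ 2 := by
    intro ξ
    have hh : (2 : ℝ).HolderConjugate 2 := Real.HolderConjugate.two_two
    have h2 := ENNReal.lintegral_mul_le_Lp_mul_Lq volume hh
      (f := fun η => k (ξ - η) ^ (1 / 2 : ℝ)) (g := fun η => k (ξ - η) ^ (1 / 2 : ℝ) * v η)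
      ((hmeas ξ).pow_const _).aemeasurable (((hmeas ξ).pow_const _).mul hv).aemeasurable
    have e1 : ∀ η, k (ξ - η) ^ (1 / 2 : ℝ) * k (ξ - η) ^ (1 / 2 : ℝ) = k (ξ - η) := by
      intro η
      rw [← ENNReal.rpow_add_of_nonneg _ _ (by norm_num) (by norm_num)]
      norm_num
    have e2 : ∀ η, (k (ξ - η) ^ (1 / 2 : ℝ)) ^ (2 : ℝ) = k (ξ - η) := by
      intro η
      rw [← ENNReal.rpow_mul]; norm_num
    simp only [Pi.mul_apply, ← mul_assoc, e1, ENNReal.mul_rpow_of_nonneg _ _ zero_le_two, e2,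
      hk'] at h2
    calc (∫⁻ η, k (ξ - η) * v η) ^ 2
        ≤ ((∫⁻ ζ, k ζ) ^ (1 / 2 : ℝ) * (∫⁻ η, k (ξ - η) * v η ^ (2 : ℝ)) ^ (1 / 2 : ℝ)) ^ 2 := by
          gcongr
      _ = _ := by
          rw [mul_pow, ← ENNReal.rpow_natCast, ← ENNReal.rpow_natCast, ← ENNReal.rpow_mul,
            ← ENNReal.rpow_mul]
          norm_num
  calc ∫⁻ ξ, (∫⁻ η, k (ξ - η) * v η) ^ 2
      ≤ ∫⁻ ξ, (∫⁻ ζ, k ζ) * ∫⁻ η, k (ξ - η) * v η ^ 2 := lintegral_mono h1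
    _ = (∫⁻ ζ, k ζ) * ∫⁻ ξ, ∫⁻ η, k (ξ - η) * v η ^ 2 := by
        refine lintegral_const_mul _ ?_
        exact Measurable.lintegral_prod_right
          ((hk.comp (measurable_fst.sub measurable_snd)).mul ((hv.comp measurable_snd).pow_const 2))
    _ = (∫⁻ ζ, k ζ) * ∫⁻ η, ∫⁻ ξ, k (ξ - η) * v η ^ 2 := by
        rw [lintegral_lintegral_swap]
        exact ((hk.comp (measurable_fst.sub measurable_snd)).mul
          ((hv.comp measurable_snd).pow_const 2)).aemeasurable
    _ = (∫⁻ ζ, k ζ) * ∫⁻ η, (∫⁻ ζ, k ζ) * v η ^ 2 := by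
        congr 1
        refine lintegral_congr fun η => ?_
        have hm : Measurable fun ξ => k (ξ - η) := hk.comp (measurable_id.sub measurable_const)
        rw [lintegral_mul_const _ hm]
        congr 1
        exact lintegral_sub_right_eq_self k η
    _ = _ := by
        rw [lintegral_const_mul _ (hv.pow_const 2), sq, mul_assoc]

theorem l2norm_le_of_fourier_le_convolution {f g : Schwartz m} {k : Space m → ℝ}
    (hk : Continuous k) (hki : Integrable k)
    (h : ∀ ξ, ‖𝓕 f ξ‖ₑ ≤ ∫⁻ η, ‖k (ξ - η)‖ₑ * ‖𝓕 g η‖ₑ) :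
    l2norm f ≤ (∫ ζ, ‖k ζ‖) * l2norm g := by
  have hfin : ∫⁻ ζ, ‖k ζ‖ₑ ≠ ⊤ := hki.2.ne
  have h1 : eLpNorm (𝓕 f : Schwartz m) 2 volume ^ 2
      ≤ ((∫⁻ ζ, ‖k ζ‖ₑ) * eLpNorm (𝓕 g : Schwartz m) 2 volume) ^ 2 := by
    rw [mul_pow, eLpNorm_two_sq, eLpNorm_two_sq]
    calc ∫⁻ ξ, ‖𝓕 f ξ‖ₑ ^ 2 ≤ ∫⁻ ξ, (∫⁻ η, ‖k (ξ - η)‖ₑ * ‖𝓕 g η‖ₑ) ^ 2 := by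
          refine lintegral_mono fun ξ => ?_
          gcongr; exact h ξ
      _ ≤ _ := lintegral_sq_convolution_le (k := fun ζ => ‖k ζ‖ₑ) hk.measurable.enorm
          (𝓕 g).continuous.measurable.enorm
  have h2 : eLpNorm (𝓕 f : Schwartz m) 2 volume
      ≤ (∫⁻ ζ, ‖k ζ‖ₑ) * eLpNorm (𝓕 g : Schwartz m) 2 volume := by
    simpa using (ENNReal.pow_le_pow_left_iff two_ne_zero).1 h1
  rw [← l2norm_fourier f, ← l2norm_fourier g, l2norm_eq_toReal, l2norm_eq_toReal,
    integral_norm_eq_lintegral_enorm hk.aestronglyMeasurable, ← ENNReal.toReal_mul]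
  exact ENNReal.toReal_mono (ENNReal.mul_ne_top hfin ((𝓕 g).eLpNorm_lt_top 2 volume).ne) h2

theorem fourier_mulS (f u : Schwartz m) (ξ : Space m) :
    𝓕 (mulS f u) ξ = ∫ η, 𝓕 f (ξ - η) * 𝓕 u η := by
  have h1 : 𝓕 (mulS f u)
      = SchwartzMap.convolution (ContinuousLinearMap.mul ℂ ℂ) (𝓕 f) (𝓕 u) := by
    -- 𝓕𝓕 is reflection, so 𝓕 maps the convolution of 𝓕 f and 𝓕 u to the reflected product, which is
    -- 𝓕𝓕(fu); injectivity of 𝓕 concludes.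
    have h2 : ∀ g : Schwartz m, 𝓕 (𝓕 g)
        = compCLMOfContinuousLinearEquiv ℂ (LinearIsometryEquiv.neg ℝ (E := Space m)) g := by
      intro g
      have h3 : (𝓕⁻ (𝓕 g) : Schwartz m) = g := FourierTransform.fourierInv_fourier_eq g
      rw [fourierInv_apply_eq] at h3
      ext x
      have h4 := DFunLike.congr_fun h3 (-x)
      simpa using h4
    have h5 : 𝓕 (SchwartzMap.convolution (ContinuousLinearMap.mul ℂ ℂ) (𝓕 f) (𝓕 u))
        = 𝓕 (𝓕 (mulS f u)) := by
      rw [fourier_convolution, h2, h2, h2]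
      ext x
      simp
    exact (fourier_injective fun ξ => DFunLike.congr_fun h5 ξ).symm
  rw [h1, convolution_apply, MeasureTheory.convolution_eq_swap]
  rfl

/-- The commutator of `Λ^ε`, `0 ≤ ε ≤ 1`, with a multiplication operator has order `ε - 1`. -/
theorem exists_l2norm_commutator_le (f : Schwartz m) {ε : ℝ} (h0 : 0 ≤ ε) (h1 : ε ≤ 1) :
    ∃ C : ℝ, 0 ≤ C ∧ ∀ u,
      l2norm (lam ε (mulS f u) - mulS f (lam ε u)) ≤ C * l2norm (lam (ε - 1) u) := by
  -- The weight ⟨ζ⟩ is the loss in `abs_bracket_rpow_sub_le`; k stays integrable because 𝓕 f is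
  -- Schwartz.
  set k : Space m → ℝ := fun ζ => ‖𝓕 f ζ‖ * bracket ζ with hkdef
  have hk : Continuous k := (𝓕 f).continuous.norm.mul continuous_bracket
  have hk0 : ∀ ζ, 0 ≤ k ζ := fun ζ => mul_nonneg (norm_nonneg _) (bracket_pos ζ).le
  have hki : Integrable k := by
    have i1 : Integrable fun ζ => ‖𝓕 f ζ‖ := (𝓕 f).integrable.norm
    have i2 : Integrable fun ζ => ‖ζ‖ ^ 1 * ‖𝓕 f ζ‖ := (𝓕 f).integrable_pow_mul volume 1
    refine (i1.add (i2.const_mul (2 * Real.pi))).mono' hk.aestronglyMeasurable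
      (Filter.Eventually.of_forall fun ζ => ?_)
    rw [Real.norm_of_nonneg (hk0 ζ)]
    have := mul_le_mul_of_nonneg_left (bracket_le ζ) (norm_nonneg (𝓕 f ζ))
    simp only [hkdef, Pi.add_apply]
    linarith
  refine ⟨∫ ζ, ‖k ζ‖, integral_nonneg fun _ => norm_nonneg _, fun u => ?_⟩
  refine l2norm_le_of_fourier_le_convolution hk hki fun ξ => ?_
  have hint : ∀ w : Schwartz m, Integrable fun η => 𝓕 f (ξ - η) * 𝓕 w η := by
    intro w
    refine (𝓕 w).integrable.bdd_mul (c := SchwartzMap.seminorm ℝ 0 0 (𝓕 f)) ?_ ?_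
    · exact ((𝓕 f).continuous.comp (continuous_const.sub continuous_id)).aestronglyMeasurable
    · exact Filter.Eventually.of_forall fun η => norm_le_seminorm ℝ _ _
  have e : 𝓕 (lam ε (mulS f u) - mulS f (lam ε u)) ξ
      = ∫ η, 𝓕 f (ξ - η) * (symbol ε ξ - symbol ε η) * 𝓕 u η := by
    have e0 : 𝓕 (lam ε (mulS f u) - mulS f (lam ε u))
        = 𝓕 (lam ε (mulS f u)) - 𝓕 (mulS f (lam ε u)) :=
      (FourierTransform.fourierCLM ℂ (Schwartz m)).map_sub _ _
    rw [e0, sub_apply, fourier_lam, fourier_mulS, fourier_mulS,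
      ← integral_const_mul, ← integral_sub ((hint u).const_mul _) (hint _)]
    refine integral_congr_ae (Filter.Eventually.of_forall fun η => ?_)
    simp only [fourier_lam]; ring
  rw [e]
  refine (enorm_integral_le_lintegral_enorm _).trans (lintegral_mono fun η => ?_)
  simp only [← ofReal_norm]
  rw [← ENNReal.ofReal_mul (norm_nonneg _)]
  refine ENNReal.ofReal_le_ofReal ?_
  rw [Real.norm_of_nonneg (hk0 _), hkdef, norm_mul, norm_mul, fourier_lam, norm_mul, norm_symbol,
    ← mul_assoc]
  refine mul_le_mul_of_nonneg_right ?_ (norm_nonneg _)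
  rw [mul_assoc]
  refine mul_le_mul_of_nonneg_left ?_ (norm_nonneg _)
  rw [symbol, symbol, ← Complex.ofReal_sub, Complex.norm_real]
  exact abs_bracket_rpow_sub_le h0 h1 ξ η

/-! ### First-order operators with Schwartz coefficients -/

/-- The first-order operator `∑ hᵢ ∂ᵢ + h₀` with Schwartz coefficients. -/
def opS (h : Fin m → Schwartz m) (h₀ u : Schwartz m) : Schwartz m :=
  ∑ i, mulS (h i) (partialD i u) + mulS h₀ u

/-- The formal adjoint of `opS h h₀`. -/
def adjS (h : Fin m → Schwartz m) (h₀ v : Schwartz m) : Schwartz m :=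
  -∑ i, partialD i (mulS (conjS (h i)) v) + mulS (conjS h₀) v

theorem l2inner_opS (h : Fin m → Schwartz m) (h₀ u v : Schwartz m) :
    l2inner (opS h h₀ u) v = l2inner u (adjS h h₀ v) := by
  have hneg : ∀ f g : Schwartz m, l2inner f (-g) = -l2inner f g := fun f g => by
    simp [l2inner, integral_neg]
  have hsum : ∀ (f : Schwartz m) (g : Fin m → Schwartz m),
      l2inner f (∑ i, g i) = ∑ i, l2inner f (g i) := fun f g => by
    simp only [l2inner_eq]
    rw [← inner_sum]
    congr 1
    exact map_sum (toLpCLM ℂ ℂ 2 (volume : Measure (Space m))) g Finset.univ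
  rw [opS, adjS, l2inner_add_left, l2inner_add_right, l2inner_sum_left, hneg, hsum, l2inner_mulS,
    ← Finset.sum_neg_distrib]
  congr 1
  refine Finset.sum_congr rfl fun i _ => ?_
  rw [l2inner_mulS, l2inner_partialD]

theorem l2norm_sum_le {ι : Type*} (s : Finset ι) (f : ι → Schwartz m) :
    l2norm (∑ i ∈ s, f i) ≤ ∑ i ∈ s, l2norm (f i) := by
  classical
  induction s using Finset.induction_on with
  | empty => simp [l2norm_zero]
  | insert a s ha ih =>
    rw [Finset.sum_insert ha, Finset.sum_insert ha]
    exact (l2norm_add_le _ _).trans (by gcongr)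

/-- The commutator of `Λ^ε` with a first-order operator has order `ε`. -/
theorem exists_l2norm_commutator_opS_le (h : Fin m → Schwartz m) (h₀ : Schwartz m) {ε : ℝ}
    (hε : 0 ≤ ε) (hε' : ε ≤ 1) :
    ∃ C : ℝ, 0 ≤ C ∧ ∀ u,
      l2norm (lam ε (opS h h₀ u) - opS h h₀ (lam ε u)) ≤ C * l2norm (lam ε u) := by
  choose C hC hCu using fun i => exists_l2norm_commutator_le (h i) hε hε'
  obtain ⟨C₀, hC₀, hC₀u⟩ := exists_l2norm_commutator_le h₀ hε hε'
  refine ⟨∑ i, C i + C₀, add_nonneg (Finset.sum_nonneg fun i _ => hC i) hC₀, fun u => ?_⟩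
  -- Λ^ε commutes with ∂ᵢ, so only commutators with the coefficients remain: order ε - 1 applied to
  -- one derivative gives order ε.
  have e : lam ε (opS h h₀ u) - opS h h₀ (lam ε u)
      = ∑ i, (lam ε (mulS (h i) (partialD i u)) - mulS (h i) (lam ε (partialD i u)))
        + (lam ε (mulS h₀ u) - mulS h₀ (lam ε u)) := by
    simp only [opS, map_add, map_sum, lam_partialD, Finset.sum_sub_distrib]
    abel
  rw [e, add_mul, Finset.sum_mul]
  refine (l2norm_add_le _ _).trans (add_le_add ((l2norm_sum_le _ _).trans
    (Finset.sum_le_sum fun i _ => ?_)) ?_)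
  · exact (hCu i _).trans (mul_le_mul_of_nonneg_left (l2norm_lam_partialD_le ε i u) (hC i))
  · exact (hC₀u u).trans (mul_le_mul_of_nonneg_left (l2norm_lam_mono (by linarith) u) hC₀)

/-! ### Bounded families and the gain of half the order -/

section Bounded

variable {T : Type*} {E : T → ℝ}

/-- The family `ψ` of Schwartz functions is bounded in `L²` by a multiple of `E`. -/
def Bounded (E : T → ℝ) (ψ : T → Schwartz m) : Prop :=
  ∃ C : ℝ, 0 ≤ C ∧ ∀ t, l2norm (ψ t) ≤ C * E t

theorem Bounded.of_le {ψ χ : T → Schwartz m} (h : Bounded E χ) {C : ℝ} (hC : 0 ≤ C)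
    (hle : ∀ t, l2norm (ψ t) ≤ C * l2norm (χ t)) : Bounded E ψ := by
  obtain ⟨D, hD, hDt⟩ := h
  refine ⟨C * D, mul_nonneg hC hD, fun t => (hle t).trans ?_⟩
  rw [mul_assoc]
  exact mul_le_mul_of_nonneg_left (hDt t) hC

theorem Bounded.add {ψ χ : T → Schwartz m} (h : Bounded E ψ) (h' : Bounded E χ) :
    Bounded E (fun t => ψ t + χ t) := by
  obtain ⟨C, hC, hCt⟩ := h
  obtain ⟨D, hD, hDt⟩ := h'
  exact ⟨C + D, add_nonneg hC hD, fun t => (l2norm_add_le _ _).trans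
    (by rw [add_mul]; exact add_le_add (hCt t) (hDt t))⟩

theorem Bounded.neg {ψ : T → Schwartz m} (h : Bounded E ψ) : Bounded E (fun t => -ψ t) :=
  h.of_le zero_le_one fun t => by rw [l2norm_neg, one_mul]

theorem Bounded.sum {ι : Type*} {s : Finset ι} {ψ : ι → T → Schwartz m}
    (h : ∀ i ∈ s, Bounded E (ψ i)) : Bounded E (fun t => ∑ i ∈ s, ψ i t) := by
  classical
  induction s using Finset.induction_on with
  | empty => exact ⟨0, le_rfl, fun t => by simp [l2norm_zero]⟩
  | insert a s ha ih =>
    simp only [Finset.sum_insert ha]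
    exact (h a (Finset.mem_insert_self a s)).add
      (ih fun i hi => h i (Finset.mem_insert_of_mem hi))

theorem Bounded.mulS {ψ : T → Schwartz m} (h : Bounded E ψ) (f : Schwartz m) :
    Bounded E (fun t => mulS f (ψ t)) := by
  obtain ⟨C, hC, hCu⟩ := exists_l2norm_mulS_le f
  exact h.of_le hC fun t => hCu _

theorem Bounded.lam_mono {ψ : T → Schwartz m} {s t : ℝ} (hst : s ≤ t)
    (h : Bounded E (fun i => lam t (ψ i))) : Bounded E (fun i => lam s (ψ i)) :=
  h.of_le zero_le_one fun i => by rw [one_mul]; exact l2norm_lam_mono hst _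

theorem Bounded.of_lam {ψ : T → Schwartz m} {s : ℝ} (hs : 0 ≤ s)
    (h : Bounded E (fun i => lam s (ψ i))) : Bounded E ψ :=
  h.of_le zero_le_one fun i => by rw [one_mul]; exact l2norm_le_lam hs _

/-- The commutator has order ε - 1 ≤ 0, so a bound for ψ alone suffices, with no control of Λ^ε ψ.
-/
theorem Bounded.lam_mulS_sub {ψ : T → Schwartz m} {ε : ℝ} (hε : 0 ≤ ε) (hε' : ε ≤ 1)
    (h : Bounded E ψ) (f : Schwartz m) :
    Bounded E (fun t => lam ε (Subelliptic.mulS f (ψ t)) - Subelliptic.mulS f (lam ε (ψ t))) := by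
  obtain ⟨C, hC, hCu⟩ := exists_l2norm_commutator_le f hε hε'
  exact h.of_le hC fun t => (hCu _).trans
    (mul_le_mul_of_nonneg_left (l2norm_lam_le (by linarith) _) hC)

theorem Bounded.lam_mulS {ψ : T → Schwartz m} {ε : ℝ} (hε : 0 ≤ ε) (hε' : ε ≤ 1)
    (h : Bounded E (fun t => lam ε (ψ t))) (f : Schwartz m) :
    Bounded E (fun t => lam ε (Subelliptic.mulS f (ψ t))) := by
  have := ((h.of_lam hε).lam_mulS_sub hε hε' f).add (h.mulS f)
  simpa using this

theorem Bounded.lam_sum {ι : Type*} {s : Finset ι} {ψ : ι → T → Schwartz m} {ε : ℝ}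
    (h : ∀ i ∈ s, Bounded E (fun t => lam ε (ψ i t))) :
    Bounded E (fun t => lam ε (∑ i ∈ s, ψ i t)) := by
  simpa only [map_sum] using Bounded.sum h

/-- The source of the factor 1/2: a pairing with Λ^ε f controls only Λ^(ε/2) f. -/
theorem l2norm_lam_half_sq (ε : ℝ) (f : Schwartz m) :
    l2norm (lam (ε / 2) f) ^ 2 = ‖l2inner f (lam ε f)‖ := by
  have h := l2inner_self (lam (ε / 2) f)
  rw [l2inner_lam, lam_lam, add_halves] at h
  rw [h, Complex.norm_real, Real.norm_of_nonneg (by positivity)]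

/-- The product of two bounded families pairs boundedly. -/
theorem Bounded.norm_l2inner_le {ψ χ : T → Schwartz m} (hE : ∀ t, 0 ≤ E t) (h : Bounded E ψ)
    (h' : Bounded E χ) : ∃ C : ℝ, 0 ≤ C ∧ ∀ t, ‖l2inner (ψ t) (χ t)‖ ≤ C * E t ^ 2 := by
  obtain ⟨C, hC, hCt⟩ := h
  obtain ⟨D, hD, hDt⟩ := h'
  refine ⟨C * D, mul_nonneg hC hD, fun t => (Subelliptic.norm_l2inner_le _ _).trans ?_⟩
  calc _ ≤ (C * E t) * (D * E t) :=
        mul_le_mul (hCt t) (hDt t) (l2norm_nonneg _) (mul_nonneg hC (hE t))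
    _ = _ := by ring

/-- The gain of half the order: if `ψ = ∑ Pᵢ uᵢ - a g + v` with first-order operators `Pᵢ`, then
`Λ^(ε/2) ψ` is controlled by `Λ^ε uᵢ`, `g`, `Λ^ε v`, `Λ^ε (a ψ)`, `ψ` and `Pᵢ* ψ`. -/
theorem Bounded.lam_half {ι : Type*} [Fintype ι] (hE : ∀ t, 0 ≤ E t) {ε : ℝ} (hε : 0 ≤ ε)
    (hε' : ε ≤ 1) (h : ι → Fin m → Schwartz m) (h₀ : ι → Schwartz m) (a : Schwartz m)
    {ψ g v : T → Schwartz m} {u : ι → T → Schwartz m}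
    (hdec : ∀ t, ψ t = ∑ i, opS (h i) (h₀ i) (u i t) - Subelliptic.mulS a (g t) + v t)
    (hu : ∀ i, Bounded E (fun t => lam ε (u i t))) (hg : Bounded E g)
    (hv : Bounded E (fun t => lam ε (v t)))
    (ha : Bounded E (fun t => lam ε (Subelliptic.mulS a (ψ t)))) (hψ : Bounded E ψ)
    (hadj : ∀ i, Bounded E (fun t => adjS (h i) (h₀ i) (ψ t))) :
    Bounded E (fun t => lam (ε / 2) (ψ t)) := by
  have h1 : ∀ i, ∃ C : ℝ, 0 ≤ C ∧ ∀ t,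
      ‖l2inner (opS (h i) (h₀ i) (u i t)) (lam ε (ψ t))‖ ≤ C * E t ^ 2 := by
    intro i
    obtain ⟨K, hK, hKu⟩ := exists_l2norm_commutator_opS_le (h i) (h₀ i) hε hε'
    obtain ⟨C, hC, hCt⟩ := Bounded.norm_l2inner_le hE ((hu i).of_le hK fun t => hKu (u i t)) hψ
    obtain ⟨D, hD, hDt⟩ := Bounded.norm_l2inner_le hE (hu i) (hadj i)
    refine ⟨C + D, add_nonneg hC hD, fun t => ?_⟩
    -- Λ^ε moves to the left entry and is commuted past Pᵢ; then Pᵢ moves to the right entry as its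
    -- adjoint.
    have e : l2inner (opS (h i) (h₀ i) (u i t)) (lam ε (ψ t))
        = l2inner (lam ε (opS (h i) (h₀ i) (u i t)) - opS (h i) (h₀ i) (lam ε (u i t))) (ψ t)
          + l2inner (lam ε (u i t)) (adjS (h i) (h₀ i) (ψ t)) := by
      rw [← l2inner_opS, ← l2inner_add_left, sub_add_cancel, l2inner_lam]
    rw [e, add_mul]
    exact (norm_add_le _ _).trans (add_le_add (hCt t) (hDt t))
  choose C hC hCt using h1
  -- Conjugating `a` does not change the norm, and a Λ^ε ψ = Λ^ε(aψ) - [Λ^ε, a]ψ.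
  have h2 : Bounded E (fun t => Subelliptic.mulS (conjS a) (lam ε (ψ t))) := by
    have h3 : Bounded E (fun t => Subelliptic.mulS a (lam ε (ψ t))) := by
      have := ha.add (hψ.lam_mulS_sub hε hε' a).neg
      simpa using this
    refine h3.of_le zero_le_one fun t => l2norm_le_of_norm_le fun x => ?_
    simp
  obtain ⟨D, hD, hDt⟩ := Bounded.norm_l2inner_le hE hg h2
  obtain ⟨F, hF, hFt⟩ := Bounded.norm_l2inner_le hE hv hψ
  have hS : 0 ≤ ∑ i, C i + D + F :=
    add_nonneg (add_nonneg (Finset.sum_nonneg fun i _ => hC i) hD) hF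
  refine ⟨Real.sqrt (∑ i, C i + D + F), Real.sqrt_nonneg _, fun t => ?_⟩
  refine (pow_le_pow_iff_left₀ (l2norm_nonneg _)
    (mul_nonneg (Real.sqrt_nonneg _) (hE t)) two_ne_zero).1 ?_
  rw [mul_pow, Real.sq_sqrt hS, l2norm_lam_half_sq]
  have e : l2inner (ψ t) (lam ε (ψ t))
      = ∑ i, l2inner (opS (h i) (h₀ i) (u i t)) (lam ε (ψ t))
        - l2inner (g t) (Subelliptic.mulS (conjS a) (lam ε (ψ t)))
        + l2inner (lam ε (v t)) (ψ t) := by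
    nth_rw 1 [hdec t]
    rw [l2inner_add_left, sub_eq_add_neg, l2inner_add_left, l2inner_sum_left, l2inner_neg_left,
      l2inner_mulS, l2inner_lam, sub_eq_add_neg]
  rw [e, add_mul, add_mul, Finset.sum_mul]
  refine (norm_add_le _ _).trans (add_le_add ((norm_sub_le _ _).trans (add_le_add
    ((norm_sum_le _ _).trans (Finset.sum_le_sum fun i _ => hCt i t)) (hDt t))) (hFt t))

end Bounded

/-! ### Product rules for first-order operators and their adjoints -/

theorem sum_apply' {ι : Type*} (s : Finset ι) (f : ι → Schwartz m) (x : Space m) :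
    (∑ i ∈ s, f i) x = ∑ i ∈ s, f i x := by
  classical
  induction s using Finset.induction_on with
  | empty => simp
  | insert a s ha ih => rw [Finset.sum_insert ha, Finset.sum_insert ha, add_apply, ih]

theorem opS_apply (h : Fin m → Schwartz m) (h₀ u : Schwartz m) (x : Space m) :
    opS h h₀ u x = ∑ i, h i x * partialD i u x + h₀ x * u x := by
  simp [opS]

/-- In the Leibniz rule the zeroth-order term is counted in both `opS h h₀ u` and `opS h h₀ a`,
hence the subtraction. -/
theorem opS_mulS_apply (h : Fin m → Schwartz m) (h₀ a u : Schwartz m) (x : Space m) :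
    opS h h₀ (mulS a u) x
      = a x * opS h h₀ u x + opS h h₀ a x * u x - h₀ x * (a x * u x) := by
  simp only [opS_apply, partialD_mulS, add_apply, mulS_apply, mul_add, Finset.sum_add_distrib,
    add_mul, Finset.mul_sum, Finset.sum_mul]
  rw [Finset.sum_congr rfl fun i _ => show h i x * (partialD i a x * u x)
    = h i x * partialD i a x * u x by ring, Finset.sum_congr rfl fun i _ =>
    show h i x * (a x * partialD i u x) = a x * (h i x * partialD i u x) by ring]
  ring

theorem opS_mulS_coeff (h : Fin m → Schwartz m) (h₀ f u : Schwartz m) :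
    opS (fun i => mulS f (h i)) (mulS f h₀) u = mulS f (opS h h₀ u) := by
  ext x
  simp only [opS_apply, mulS_apply, mul_add, Finset.mul_sum, mul_assoc]

theorem partialD_sum {ι : Type*} (s : Finset ι) (i : Fin m) (u : ι → Schwartz m) :
    partialD i (∑ j ∈ s, u j) = ∑ j ∈ s, partialD i (u j) :=
  map_sum (LineDeriv.lineDerivOpCLM ℂ (Schwartz m) (EuclideanSpace.single i (1 : ℝ))) u s

theorem opS_sum {ι : Type*} (s : Finset ι) (h : Fin m → Schwartz m) (h₀ : Schwartz m)
    (u : ι → Schwartz m) : opS h h₀ (∑ j ∈ s, u j) = ∑ j ∈ s, opS h h₀ (u j) := by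
  simp only [opS, partialD_sum, mulS_sum, Finset.sum_add_distrib]
  rw [Finset.sum_comm]

theorem adjS_sum {ι : Type*} (s : Finset ι) (h : Fin m → Schwartz m) (h₀ : Schwartz m)
    (u : ι → Schwartz m) : adjS h h₀ (∑ j ∈ s, u j) = ∑ j ∈ s, adjS h h₀ (u j) := by
  simp only [adjS, partialD_sum, mulS_sum, Finset.sum_add_distrib, Finset.sum_neg_distrib]
  rw [Finset.sum_comm]

/-- Only the derivatives of conj f · b obstruct pulling that factor out, and they leave a term of
order zero in u. Thus a bound for X*u and for u yields one for (fX)*(bu). -/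
theorem adjS_mulS_coeff (h : Fin m → Schwartz m) (h₀ f b u : Schwartz m) :
    adjS (fun i => mulS f (h i)) (mulS f h₀) (mulS b u)
      = mulS (mulS (conjS f) b) (adjS h h₀ u)
        + -∑ i, mulS (mulS (partialD i (mulS (conjS f) b)) (conjS (h i))) u := by
  have e : ∀ i, mulS (conjS (mulS f (h i))) (mulS b u)
      = mulS (mulS (conjS f) b) (mulS (conjS (h i)) u) := by
    intro i; ext x; simp only [mulS_apply, conjS_apply, map_mul]; ring
  have hneg : ∀ f g : Schwartz m, mulS f (-g) = -mulS f g := fun f g => by ext x; simp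
  simp only [adjS, e, mulS_add, hneg, mulS_sum]
  simp only [partialD_mulS (f := mulS (conjS f) b), Finset.sum_add_distrib]
  ext x
  simp only [add_apply, neg_apply, sum_apply', mulS_apply, conjS_apply, map_mul, mul_assoc]
  ring

theorem Bounded.adjS_mulS {T : Type*} {E : T → ℝ} {u : T → Schwartz m} (h : Fin m → Schwartz m)
    (h₀ f b : Schwartz m) (hu : Bounded E u) (ha : Bounded E (fun t => adjS h h₀ (u t))) :
    Bounded E (fun t => adjS (fun i => Subelliptic.mulS f (h i)) (Subelliptic.mulS f h₀)
      (Subelliptic.mulS b (u t))) := by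
  simp only [adjS_mulS_coeff]
  exact (ha.mulS _).add (Bounded.sum fun i _ => hu.mulS _).neg

/-! ### Cutoff to Schwartz functions -/

/-- On a small ball, smooth functions agree with Schwartz functions supported in `W`. -/
theorem exists_schwartz_cutoff {W : Set (Space m)} (hW : IsOpen W) (h0 : 0 ∈ W) :
    ∃ r : ℝ, 0 < r ∧ Metric.ball 0 r ⊆ W ∧ ∀ c : Space m → ℂ, ContDiffOn ℝ ∞ c W →
      ∃ s : Schwartz m, (∀ x ∉ W, s x = 0) ∧ ∀ x ∈ Metric.ball 0 r, s x = c x := by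
  obtain ⟨R, hR, hRW⟩ := Metric.isOpen_iff.1 hW 0 h0
  -- χ is 1 on the ball of radius R/4 and supported in that of radius R/2, inside W. One bump serves
  -- every c, so r does not depend on c.
  let χ : ContDiffBump (0 : Space m) := ⟨R / 4, R / 2, by positivity, by linarith⟩
  have hsub : tsupport χ ⊆ W := by
    rw [χ.tsupport_eq]
    refine (Metric.closedBall_subset_ball ?_).trans hRW
    change R / 2 < R
    linarith
  refine ⟨R / 4, by positivity, (Metric.ball_subset_ball (by linarith)).trans hRW, fun c hc => ?_⟩
  have hsm : ContDiff ℝ ∞ (fun x => (χ x : ℂ) * c x) := by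
    rw [contDiff_iff_contDiffAt]
    intro x
    by_cases hx : x ∈ W
    · exact (Complex.ofRealCLM.contDiff.comp χ.contDiff).contDiffAt.mul
        (hc.contDiffAt (hW.mem_nhds hx))
    · have h2 := notMem_tsupport_iff_eventuallyEq.1 (fun h => hx (hsub h))
      refine contDiffAt_const (c := (0 : ℂ)) |>.congr_of_eventuallyEq ?_
      filter_upwards [h2] with y hy
      simp [hy]
  have hcs : HasCompactSupport (fun x => (χ x : ℂ) * c x) := by
    refine HasCompactSupport.mul_right ?_
    exact χ.hasCompactSupport.comp_left (g := fun r : ℝ => (r : ℂ)) Complex.ofReal_zero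
  refine ⟨hcs.toSchwartzMap hsm, fun x hx => ?_, fun x hx => ?_⟩
  · have : χ x = 0 := image_eq_zero_of_notMem_tsupport fun h => hx (hsub h)
    change (χ x : ℂ) * c x = 0
    simp [this]
  · have : χ x = 1 := χ.one_of_mem_closedBall (Metric.ball_subset_closedBall hx)
    change (χ x : ℂ) * c x = c x
    simp [this]

/-! ### Test tuples: between estimability on Ω and bounds on ℝᵐ -/

variable {q N : ℕ} {Ω U : Set (Space m)} {Y : Fin N → Fin q → DiffOp Ω}

/-- The tuples of test functions on `U` of finite energy. -/
def TestTuple (Ω : Set (Space m)) (Y : Fin N → Fin q → DiffOp Ω) (U : Set (Space m)) : Type :=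
  {φ : Fin q → Space m → ℂ // (∀ ν, IsTest U (φ ν)) ∧ energy Ω Y φ ≠ ⊤}

/-- The components of a test tuple as Schwartz functions. -/
def TestTuple.comp (t : TestTuple Ω Y U) (ν : Fin q) : Schwartz m :=
  (t.2.1 ν).2.1.toSchwartzMap (t.2.1 ν).1

/-- The square root of the energy. -/
def TestTuple.size (t : TestTuple Ω Y U) : ℝ := Real.sqrt (energy Ω Y t.1).toReal

theorem TestTuple.size_nonneg (t : TestTuple Ω Y U) : 0 ≤ t.size := Real.sqrt_nonneg _

theorem TestTuple.coe_comp (t : TestTuple Ω Y U) (ν : Fin q) : ⇑(t.comp ν) = t.1 ν := rfl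

theorem TestTuple.ofReal_size_sq (t : TestTuple Ω Y U) :
    ENNReal.ofReal (t.size ^ 2) = energy Ω Y t.1 := by
  rw [size, Real.sq_sqrt ENNReal.toReal_nonneg, ENNReal.ofReal_toReal t.2.2]

/-- The dichotomy behind all pointwise comparisons: on U the Schwartz coefficients are the true
ones, and elsewhere φ_ν vanishes as a germ, so its derivatives vanish too. -/
theorem TestTuple.mem_or_eventuallyEq_zero (t : TestTuple Ω Y U) (ν : Fin q) (x : Space m) :
    x ∈ U ∨ t.1 ν =ᶠ[nhds x] 0 := by
  by_cases hx : x ∈ tsupport (t.1 ν)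
  · exact Or.inl ((t.2.1 ν).2.2 hx)
  · exact Or.inr (notMem_tsupport_iff_eventuallyEq.1 hx)

/-- Vanishing of Ψ off Ω turns the norm over Ω into the norm over ℝᵐ. Square roots are taken since
`Bounded` is linear in the norm while `Estimable` is quadratic. -/
theorem Bounded.of_estimable {U' : Set (Space m)} (hΩ : MeasurableSet Ω) (hU : U ⊆ U')
    {ψ : (Fin q → Space m → ℂ) → Space m → ℂ} (h : Estimable Ω Y U' ψ)
    {Ψ : TestTuple Ω Y U → Schwartz m} {C : ℝ≥0}
    (hle : ∀ t, ∀ x ∈ Ω, ‖Ψ t x‖ ≤ C * ‖ψ t.1 x‖) (hzero : ∀ t, ∀ x ∉ Ω, Ψ t x = 0) :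
    Bounded TestTuple.size Ψ := by
  obtain ⟨D, hD, hDt⟩ := h
  refine ⟨C * Real.sqrt D, by positivity, fun t => ?_⟩
  refine (pow_le_pow_iff_left₀ (l2norm_nonneg _) (mul_nonneg (by positivity) t.size_nonneg)
    two_ne_zero).1 ?_
  rw [mul_pow, mul_pow, Real.sq_sqrt D.coe_nonneg]
  have h1 := hDt t.1 fun ν => ⟨(t.2.1 ν).1, (t.2.1 ν).2.1, (t.2.1 ν).2.2.trans hU⟩
  have h2 : eLpNorm (Ψ t) 2 volume = eLpNorm (Ψ t) 2 (volume.restrict Ω) := by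
    rw [← eLpNorm_indicator_eq_eLpNorm_restrict hΩ]
    congr 1
    ext x
    by_cases hx : x ∈ Ω
    · simp [hx]
    · simp [hx, hzero t x hx]
  have h3 : eLpNorm (Ψ t) 2 (volume.restrict Ω) ≤ C * eLpNorm (ψ t.1) 2 (volume.restrict Ω) := by
    have := eLpNorm_le_mul_eLpNorm_of_ae_le_mul (p := 2) (μ := volume.restrict Ω)
      (f := Ψ t) (g := ψ t.1) (c := C)
      ((ae_restrict_iff' hΩ).2 (Filter.Eventually.of_forall fun x hx => hle t x hx))
    simpa using this
  have h4 : ENNReal.ofReal (l2norm (Ψ t) ^ 2) ≤ ENNReal.ofReal (C ^ 2 * D * t.size ^ 2) := by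
    rw [ENNReal.ofReal_pow (l2norm_nonneg _), ofReal_l2norm, h2,
      ENNReal.ofReal_mul (by positivity), t.ofReal_size_sq, ENNReal.ofReal_mul (by positivity),
      ENNReal.ofReal_pow (by positivity), ENNReal.ofReal_coe_nnreal, ENNReal.ofReal_coe_nnreal]
    calc _ ≤ (C * eLpNorm (ψ t.1) 2 (volume.restrict Ω)) ^ 2 := by gcongr
      _ = C ^ 2 * normSq Ω (ψ t.1) := by rw [mul_pow, normSq]
      _ ≤ C ^ 2 * (D * energy Ω Y t.1) := by gcongr
      _ = _ := by ring
  exact (ENNReal.ofReal_le_ofReal_iff (by positivity)).1 h4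

theorem Bounded.comp (hΩ : MeasurableSet Ω) (hU : U ⊆ Ω) (ν : Fin q) :
    Bounded TestTuple.size (fun t : TestTuple Ω Y U => t.comp ν) := by
  have h : Estimable Ω Y U (fun φ => φ ν) := by
    refine ⟨1, one_pos, fun φ _ => ?_⟩
    rw [ENNReal.coe_one, one_mul, energy]
    exact (Finset.single_le_sum (f := fun ν => normSq Ω (φ ν)) (fun _ _ => zero_le)
      (Finset.mem_univ ν)).trans le_self_add
  refine Bounded.of_estimable hΩ subset_rfl h (C := 1) (fun t x _ => ?_) (fun t x hx => ?_)
  · simp [t.coe_comp]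
  · rw [t.coe_comp]
    exact image_eq_zero_of_notMem_tsupport fun h => hx (hU ((t.2.1 ν).2.2 h))

/-- Estimates of `Λ^ε ψ` on `Ω` are estimates on all of `ℝᵐ`, since `Λ^ε` is pseudolocal. -/
theorem Bounded.lam_of_estimable {U' : Set (Space m)} (hΩ : MeasurableSet Ω) (hU : U ⊆ U')
    {ε : ℝ} (hε : 0 ≤ ε) (hε' : ε ≤ 1) {ψ : (Fin q → Space m → ℂ) → Space m → ℂ}
    (h : Estimable Ω Y U' (fun φ => Lam ε (ψ φ))) {Ψ : TestTuple Ω Y U → Schwartz m}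
    (hΨ : ∀ t, ⇑(Ψ t) = ψ t.1) (hb : Bounded TestTuple.size Ψ) {χ : Schwartz m}
    (hχ : ∀ x ∉ Ω, χ x = 0) (hχΨ : ∀ t, Subelliptic.mulS χ (Ψ t) = Ψ t) :
    Bounded TestTuple.size (fun t => lam ε (Ψ t)) := by
  -- The cutoff vanishes off Ω, so the estimate on Ω suffices for χ Λ^ε Ψ.
  have h1 : Bounded TestTuple.size (fun t => Subelliptic.mulS χ (lam ε (Ψ t))) := by
    refine Bounded.of_estimable hΩ hU h (C := (SchwartzMap.seminorm ℝ 0 0 χ).toNNReal)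
      (fun t x _ => ?_) (fun t x hx => by simp [hχ x hx])
    rw [mulS_apply, norm_mul, ← hΨ, ← coe_lam]
    exact mul_le_mul_of_nonneg_right
      ((norm_le_seminorm ℝ χ x).trans (Real.le_coe_toNNReal _)) (norm_nonneg _)
  -- As χΨ = Ψ, one has Λ^ε Ψ = [Λ^ε, χ]Ψ + χ Λ^ε Ψ.
  have := (hb.lam_mulS_sub hε hε' χ).add h1
  simpa [hχΨ] using this

theorem Bounded.estimable {ψ : (Fin q → Space m → ℂ) → Space m → ℂ}
    {Ψ : TestTuple Ω Y U → Schwartz m} (h : Bounded TestTuple.size Ψ)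
    (hΨ : ∀ t, ⇑(Ψ t) = ψ t.1) : Estimable Ω Y U ψ := by
  obtain ⟨C, hC, hCt⟩ := h
  lift C to ℝ≥0 using hC
  -- The 1 keeps the constant positive when C = 0. Tuples of infinite energy satisfy the inequality
  -- trivially.
  refine ⟨C ^ 2 + 1, by positivity, fun φ hφ => ?_⟩
  by_cases hE : energy Ω Y φ = ⊤
  · rw [hE, ENNReal.mul_top]
    · exact le_top
    · rw [ENNReal.coe_ne_zero]
      positivity
  · let t : TestTuple Ω Y U := ⟨φ, hφ, hE⟩
    have h1 : normSq Ω (ψ φ) ≤ ENNReal.ofReal (l2norm (Ψ t) ^ 2) := by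
      rw [ENNReal.ofReal_pow (l2norm_nonneg _), ofReal_l2norm, hΨ t, normSq]
      gcongr
      exact Measure.restrict_le_self
    refine h1.trans ?_
    have h2 : l2norm (Ψ t) ^ 2 ≤ (C ^ 2 + 1) * t.size ^ 2 := by
      calc _ ≤ (C * t.size) ^ 2 := pow_le_pow_left₀ (l2norm_nonneg _) (hCt t) 2
        _ ≤ _ := by nlinarith [sq_nonneg t.size]
    refine (ENNReal.ofReal_le_ofReal h2).trans ?_
    rw [ENNReal.ofReal_mul (by positivity), t.ofReal_size_sq]
    refine le_of_eq ?_
    congr 1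
    exact_mod_cast ENNReal.ofReal_coe_nnreal (p := C ^ (2 : ℕ) + 1)

/-! ### The given operators and multipliers in terms of Schwartz coefficients -/

theorem pderiv_congr {f g : Space m → ℂ} {x : Space m} (h : f =ᶠ[nhds x] g) (i : Fin m) :
    pderiv i f x = pderiv i g x := by
  rw [pderiv, pderiv, h.fderiv_eq]

theorem FirstOrderOp.apply_congr (X : FirstOrderOp Ω) {f g : Space m → ℂ} {x : Space m}
    (h : f =ᶠ[nhds x] g) : X.apply f x = X.apply g x := by
  simp only [FirstOrderOp.apply, pderiv_congr h, h.eq_of_nhds]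

/-- The Schwartz functions `h`, `h₀` agree on `U` with the coefficients of `X`. -/
def CoeffEqOn (X : FirstOrderOp Ω) (U : Set (Space m)) (h : Fin m → Schwartz m)
    (h₀ : Schwartz m) : Prop :=
  (∀ i, ∀ x ∈ U, h i x = X.ξ i x) ∧ ∀ x ∈ U, h₀ x = X.ζ x

theorem CoeffEqOn.opS_eq {X : FirstOrderOp Ω} {h : Fin m → Schwartz m} {h₀ : Schwartz m}
    (hX : CoeffEqOn X U h h₀) {x : Space m} (hx : x ∈ U) {F : Schwartz m} {f : Space m → ℂ}
    (hF : F =ᶠ[nhds x] f) : opS h h₀ F x = X.apply f x := by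
  rw [← X.apply_congr hF, opS_apply, FirstOrderOp.apply, hX.2 x hx]
  simp only [coe_partialD, hX.1 _ x hx]

theorem pderiv_eq_zero {f : Space m → ℂ} {x : Space m} (h : f =ᶠ[nhds x] 0) (i : Fin m) :
    pderiv i f x = 0 := by
  rw [pderiv_congr h]; simp [pderiv]

theorem CoeffEqOn.opS_comp_apply {X : FirstOrderOp Ω} {h : Fin m → Schwartz m} {h₀ : Schwartz m}
    (hX : CoeffEqOn X U h h₀) (t : TestTuple Ω Y U) (ν : Fin q) (x : Space m) :
    opS h h₀ (t.comp ν) x = X.apply (t.1 ν) x := by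
  rcases t.mem_or_eventuallyEq_zero ν x with hx | hx
  · exact hX.opS_eq hx (Filter.EventuallyEq.of_eq (t.coe_comp ν))
  · rw [opS_apply, FirstOrderOp.apply]
    simp [coe_partialD, t.coe_comp, pderiv_eq_zero hx, hx.eq_of_nhds]

theorem CoeffEqOn.adjS_comp_apply {X : FirstOrderOp Ω} {h : Fin m → Schwartz m} {h₀ : Schwartz m}
    (hU : IsOpen U) (hX : CoeffEqOn X U h h₀) (t : TestTuple Ω Y U) (ν : Fin q) (x : Space m) :
    adjS h h₀ (t.comp ν) x = X.adjoint (t.1 ν) x := by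
  have e : adjS h h₀ (t.comp ν) x
      = -∑ i, pderiv i (fun y => conj (h i y) * t.1 ν y) x + conj (h₀ x) * t.1 ν x := by
    simp only [adjS, add_apply, neg_apply, sum_apply', coe_partialD]
    rfl
  rw [e, FirstOrderOp.adjoint]
  rcases t.mem_or_eventuallyEq_zero ν x with hx | hx
  · rw [hX.2 x hx]
    congr 2
    -- In the adjoint the coefficients stand under the derivative, so they must agree near x and not
    -- only at x; U is open.
    refine Finset.sum_congr rfl fun i _ => pderiv_congr ?_ i
    filter_upwards [hU.mem_nhds hx] with y hy
    rw [hX.1 i y hy]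
  · have h1 : ∀ c : Space m → ℂ, (fun y => c y * t.1 ν y) =ᶠ[nhds x] 0 := by
      intro c
      filter_upwards [hx] with y hy
      simp [hy]
    simp [pderiv_eq_zero (h1 _), hx.eq_of_nhds]

theorem FirstOrderOp.apply_eq_zero (X : FirstOrderOp Ω) {f : Space m → ℂ} {x : Space m}
    (h : f =ᶠ[nhds x] 0) : X.apply f x = 0 := by
  simp [FirstOrderOp.apply, pderiv_eq_zero h, h.eq_of_nhds]

theorem TestTuple.comp_apply_eq_zero (t : TestTuple Ω Y U) (ν : Fin q) {x : Space m}
    (hx : x ∉ U) : t.comp ν x = 0 :=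
  ((t.mem_or_eventuallyEq_zero ν x).resolve_left hx).eq_of_nhds

theorem TestTuple.mulS_comp_eq (t : TestTuple Ω Y U) (ν : Fin q) {s : Schwartz m}
    {f : Space m → ℂ} (h : ∀ x ∈ U, s x = f x) (x : Space m) :
    mulS s (t.comp ν) x = f x * t.1 ν x := by
  by_cases hx : x ∈ U
  · rw [mulS_apply, h x hx, t.coe_comp]
  · rw [mulS_apply, t.comp_apply_eq_zero ν hx, ← t.coe_comp, t.comp_apply_eq_zero ν hx]; simp

/-- Pairing the tuple with coefficients `s`, as a Schwartz function. -/
def TestTuple.pair (t : TestTuple Ω Y U) (s : Fin q → Schwartz m) : Schwartz m :=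
  ∑ ν, mulS (s ν) (t.comp ν)

theorem TestTuple.coe_pair (t : TestTuple Ω Y U) {s : Fin q → Schwartz m}
    {f : Fin q → Space m → ℂ} (h : ∀ ν, ∀ x ∈ U, s ν x = f ν x) :
    ⇑(t.pair s) = fun x => ∑ ν, f ν x * t.1 ν x := by
  ext x
  rw [pair, sum_apply']
  exact Finset.sum_congr rfl fun ν _ => t.mulS_comp_eq ν (h ν) x

theorem Bounded.pair (hΩ : MeasurableSet Ω) (hU : U ⊆ Ω) (s : Fin q → Schwartz m) :
    Bounded TestTuple.size (fun t : TestTuple Ω Y U => t.pair s) :=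
  Bounded.sum fun ν _ => (Bounded.comp hΩ hU ν).mulS _

theorem Bounded.adjS_comp (hΩ : MeasurableSet Ω) (hU : IsOpen U) (hUΩ : U ⊆ Ω)
    {X : FirstOrderOp Ω} {h : Fin m → Schwartz m} {h₀ : Schwartz m} (hX : CoeffEqOn X U h h₀)
    (ν : Fin q) (hest : Estimable Ω Y Ω (fun φ => X.adjoint (φ ν))) :
    Bounded TestTuple.size (fun t : TestTuple Ω Y U => adjS h h₀ (t.comp ν)) := by
  refine Bounded.of_estimable hΩ hUΩ hest (C := 1) (fun t x _ => ?_) (fun t x hx => ?_)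
  · simp [hX.adjS_comp_apply hU t ν x]
  · have hx' := (t.mem_or_eventuallyEq_zero ν x).resolve_left fun h => hx (hUΩ h)
    have h1 : ∀ c : Space m → ℂ, (fun y => c y * t.1 ν y) =ᶠ[nhds x] 0 := by
      intro c
      filter_upwards [hx'] with y hy
      simp [hy]
    rw [hX.adjS_comp_apply hU t ν x, FirstOrderOp.adjoint]
    simp [pderiv_eq_zero (h1 _), hx'.eq_of_nhds]

theorem Bounded.sum_mulS_opS_comp (hΩ : MeasurableSet Ω) (hUΩ : U ⊆ Ω)
    {X : Fin q → FirstOrderOp Ω} {h : Fin q → Fin m → Schwartz m} {h₀ : Fin q → Schwartz m}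
    (hX : ∀ k, CoeffEqOn (X k) U (h k) (h₀ k)) {Γ : Fin q → Fin q → Space m → ℂ}
    {G : Fin q → Fin q → Schwartz m} (hG : ∀ k l, ∀ x ∈ U, G k l x = Γ k l x)
    (hest : Estimable Ω Y Ω (fun φ x => ∑ k, ∑ l, Γ k l x * (X k).apply (φ l) x)) :
    Bounded TestTuple.size (fun t : TestTuple Ω Y U =>
      ∑ k, ∑ l, Subelliptic.mulS (G k l) (opS (h k) (h₀ k) (t.comp l))) := by
  have key : ∀ (t : TestTuple Ω Y U) x,
      (∑ k, ∑ l, Subelliptic.mulS (G k l) (opS (h k) (h₀ k) (t.comp l))) x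
        = ∑ k, ∑ l, Γ k l x * (X k).apply (t.1 l) x := by
    intro t x
    simp only [sum_apply', mulS_apply]
    refine Finset.sum_congr rfl fun k _ => Finset.sum_congr rfl fun l _ => ?_
    rw [(hX k).opS_comp_apply t l x]
    rcases t.mem_or_eventuallyEq_zero l x with hx | hx
    · rw [hG k l x hx]
    · rw [(X k).apply_eq_zero hx, mul_zero, mul_zero]
  refine Bounded.of_estimable hΩ hUΩ hest (C := 1) (fun t x _ => ?_) (fun t x hx => ?_)
  · simp [key t x]
  · rw [key t x]
    refine Finset.sum_eq_zero fun k _ => Finset.sum_eq_zero fun l _ => ?_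
    rw [(X k).apply_eq_zero ((t.mem_or_eventuallyEq_zero l x).resolve_left fun h => hx (hUΩ h)),
      mul_zero]

/-- Vector multipliers give bounds for `Λ^ε` of the pairing on smaller neighborhoods. -/
theorem Bounded.lam_pair (hΩ : MeasurableSet Ω) (hUΩ : U ⊆ Ω) {U' : Set (Space m)} (hU : U ⊆ U')
    {ε : ℝ} (hε : 0 ≤ ε) (hε' : ε ≤ 1) {a : Fin q → Space m → ℂ}
    (hest : Estimable Ω Y U' (fun φ => Lam ε (fun x => ∑ ν, a ν x * φ ν x)))
    {s : Fin q → Schwartz m} (hs : ∀ ν, ∀ x ∈ U, s ν x = a ν x) {χ : Schwartz m}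
    (hχ : ∀ x ∉ Ω, χ x = 0) (hχU : ∀ x ∈ U, χ x = 1) :
    Bounded TestTuple.size (fun t : TestTuple Ω Y U => lam ε (t.pair s)) := by
  refine Bounded.lam_of_estimable hΩ hU hε hε' hest (fun t => t.coe_pair hs)
    (Bounded.pair hΩ hUΩ s) hχ fun t => ?_
  ext x
  by_cases hx : x ∈ U
  · rw [mulS_apply, hχU x hx, one_mul]
  · have : t.pair s x = 0 := by
      rw [TestTuple.pair, sum_apply']
      exact Finset.sum_eq_zero fun ν _ => by rw [mulS_apply, t.comp_apply_eq_zero ν hx, mul_zero]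
    rw [mulS_apply, this, mul_zero]

/-- Scalar multipliers give bounds for `Λ^ε` of the products on smaller neighborhoods. -/
theorem Bounded.lam_mulS_comp (hΩ : MeasurableSet Ω) (hUΩ : U ⊆ Ω) {U' : Set (Space m)}
    (hU : U ⊆ U') {ε : ℝ} (hε : 0 ≤ ε) (hε' : ε ≤ 1) {α : Space m → ℂ} {ν : Fin q}
    (hest : Estimable Ω Y U' (fun φ => Lam ε (fun x => α x * φ ν x)))
    {s : Schwartz m} (hs : ∀ x ∈ U, s x = α x) {χ : Schwartz m}
    (hχ : ∀ x ∉ Ω, χ x = 0) (hχU : ∀ x ∈ U, χ x = 1) :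
    Bounded TestTuple.size (fun t : TestTuple Ω Y U => lam ε (Subelliptic.mulS s (t.comp ν))) := by
  refine Bounded.lam_of_estimable hΩ hU hε hε' hest
    (fun t => funext fun x => t.mulS_comp_eq ν hs x)
    ((Bounded.comp hΩ hUΩ ν).mulS s) hχ fun t => ?_
  ext x
  by_cases hx : x ∈ U
  · rw [mulS_apply, hχU x hx, one_mul]
  · rw [mulS_apply, mulS_apply, t.comp_apply_eq_zero ν hx, mul_zero, mul_zero]

/-! ### The general procedure -/

/-- The pointwise identity `∑ bⱼ φⱼ = ∑ F_pl X_p u_l - α ∑ Γ_kl X_k φ_l + ∑ F_pl ζ_p u_l`, where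
`F_pl = ∑ Γ_pk A_kl` and `u_l = ∑ a_lj φ_j`. -/
theorem sum_identity {q : ℕ} (G A a D : Fin q → Fin q → ℂ) (α : ℂ) (Xa : Fin q → Fin q → Fin q → ℂ)
    (z φ : Fin q → ℂ)
    (hA : ∀ k j p, (∑ l, A k l * a l j) * D p j = α * (if k = j then 1 else 0) * D p j) :
    ∑ j, (∑ p, ∑ l, ∑ k, G p k * A k l * Xa p l j) * φ j
      = ∑ p, ∑ l, (∑ k, G p k * A k l)
            * ∑ j, (a l j * D p j + Xa p l j * φ j - z p * (a l j * φ j))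
        - α * ∑ k, ∑ l, G k l * D k l
        + ∑ p, ∑ l, (∑ k, G p k * A k l) * (z p * ∑ j, a l j * φ j) := by
  -- Here D p j stands for X_p φ_j; the sum over l produces A a = α I and collapses F a to αΓ.
  have h1 : ∑ p, ∑ l, (∑ k, G p k * A k l) * ∑ j, a l j * D p j
      = α * ∑ k, ∑ l, G k l * D k l := by
    rw [Finset.mul_sum]
    refine Finset.sum_congr rfl fun p _ => ?_
    calc ∑ l, (∑ k, G p k * A k l) * ∑ j, a l j * D p j
        = ∑ l, ∑ k, ∑ j, G p k * (A k l * a l j * D p j) := by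
          refine Finset.sum_congr rfl fun l _ => ?_
          rw [Finset.sum_mul]
          refine Finset.sum_congr rfl fun k _ => ?_
          rw [Finset.mul_sum]
          exact Finset.sum_congr rfl fun j _ => by ring
      _ = ∑ k, ∑ j, ∑ l, G p k * (A k l * a l j * D p j) := by
          rw [Finset.sum_comm]
          exact Finset.sum_congr rfl fun k _ => Finset.sum_comm
      _ = ∑ k, ∑ j, G p k * (α * (if k = j then 1 else 0) * D p j) := by
          refine Finset.sum_congr rfl fun k _ => Finset.sum_congr rfl fun j _ => ?_
          rw [← hA, ← Finset.mul_sum, Finset.sum_mul]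
      _ = ∑ k, α * (G p k * D p k) := by
          refine Finset.sum_congr rfl fun k _ => ?_
          rw [Finset.sum_eq_single k (fun j _ hj => by simp [hj.symm]) (by simp)]
          simp; ring
      _ = _ := by rw [Finset.mul_sum]
  have h2 : ∑ j, (∑ p, ∑ l, ∑ k, G p k * A k l * Xa p l j) * φ j
      = ∑ p, ∑ l, (∑ k, G p k * A k l) * ∑ j, Xa p l j * φ j := by
    simp only [Finset.sum_mul, Finset.mul_sum]
    rw [Finset.sum_comm]
    refine Finset.sum_congr rfl fun p _ => ?_
    rw [Finset.sum_comm]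
    refine Finset.sum_congr rfl fun l _ => ?_
    exact Finset.sum_congr rfl fun j _ => Finset.sum_congr rfl fun k _ => by ring
  rw [h2, ← h1, ← Finset.sum_sub_distrib, ← Finset.sum_add_distrib]
  refine Finset.sum_congr rfl fun p _ => ?_
  rw [← Finset.sum_sub_distrib, ← Finset.sum_add_distrib]
  refine Finset.sum_congr rfl fun l _ => ?_
  rw [Finset.sum_sub_distrib, Finset.sum_add_distrib, ← Finset.mul_sum]
  ring

theorem TestTuple.opS_pair_apply (t : TestTuple Ω Y U) (h : Fin m → Schwartz m) (h₀ : Schwartz m)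
    (s : Fin q → Schwartz m) (x : Space m) :
    opS h h₀ (t.pair s) x = ∑ j, (s j x * opS h h₀ (t.comp j) x + opS h h₀ (s j) x * t.comp j x
      - h₀ x * (s j x * t.comp j x)) := by
  rw [TestTuple.pair, opS_sum, sum_apply']
  exact Finset.sum_congr rfl fun j _ => opS_mulS_apply _ _ _ _ _

/-- The general procedure on a neighborhood where all coefficients are Schwartz functions. -/
theorem Bounded.lam_half_pair (hΩ : MeasurableSet Ω) (hU : IsOpen U) (hUΩ : U ⊆ Ω)
    {X : Fin q → FirstOrderOp Ω} (hX : ∀ j ν, Estimable Ω Y Ω (fun φ => (X j).adjoint (φ ν)))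
    {Γ : Fin q → Fin q → Space m → ℂ}
    (hΓX : Estimable Ω Y Ω (fun φ x => ∑ k, ∑ l, Γ k l x * (X k).apply (φ l) x))
    {h : Fin q → Fin m → Schwartz m} {h₀ : Fin q → Schwartz m}
    (hh : ∀ k, CoeffEqOn (X k) U (h k) (h₀ k))
    {G a A : Fin q → Fin q → Schwartz m} (hG : ∀ k l, ∀ x ∈ U, G k l x = Γ k l x)
    {α : Schwartz m}
    (hA : ∀ x ∈ U, ∀ k j, ∑ l, A k l x * a l j x = α x * (if k = j then 1 else 0))
    {ε : ℝ} (hε : 0 ≤ ε) (hε' : ε ≤ 1)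
    (ha : ∀ l, Bounded TestTuple.size (fun t : TestTuple Ω Y U => lam ε (t.pair (a l))))
    (hα : ∀ ν, Bounded TestTuple.size
      (fun t : TestTuple Ω Y U => lam ε (Subelliptic.mulS α (t.comp ν)))) :
    Bounded TestTuple.size (fun t : TestTuple Ω Y U => lam (ε / 2) (t.pair fun j =>
      ∑ p, ∑ l, ∑ k, Subelliptic.mulS (Subelliptic.mulS (G p k) (A k l))
        (opS (h p) (h₀ p) (a l j)))) := by
  set b : Fin q → Schwartz m := fun j => ∑ p, ∑ l, ∑ k,
    Subelliptic.mulS (Subelliptic.mulS (G p k) (A k l)) (opS (h p) (h₀ p) (a l j)) with hb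
  let F : Fin q → Fin q → Schwartz m := fun p l => ∑ k, Subelliptic.mulS (G p k) (A k l)
  -- The operators are F_pl X_p, indexed by the pair (p, l), with F_pl absorbed in the coefficients.
  refine Bounded.lam_half (ι := Fin q × Fin q) TestTuple.size_nonneg hε hε'
    (fun i n => Subelliptic.mulS (F i.1 i.2) (h i.1 n))
    (fun i => Subelliptic.mulS (F i.1 i.2) (h₀ i.1)) α
    (g := fun t => ∑ k, ∑ l, Subelliptic.mulS (G k l) (opS (h k) (h₀ k) (t.comp l)))
    (v := fun t => ∑ p, ∑ l, Subelliptic.mulS (F p l) (Subelliptic.mulS (h₀ p) (t.pair (a l))))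
    (u := fun i t => t.pair (a i.2)) (fun t => ?_) (fun i => ha i.2)
    (Bounded.sum_mulS_opS_comp hΩ hUΩ hh hG hΓX) ?_ ?_ (Bounded.pair hΩ hUΩ b) fun i => ?_
  · ext x
    have hp : ∀ s : Fin q → Schwartz m, t.pair s x = ∑ j, s j x * t.comp j x := fun s => by
      rw [TestTuple.pair, sum_apply']; rfl
    simp only [opS_mulS_coeff, add_apply, sub_apply, sum_apply', mulS_apply,
      Fintype.sum_prod_type, t.opS_pair_apply, hp, hb, F]
    refine sum_identity _ _ _ _ _ _ _ _ fun k j p => ?_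
    -- A a = α I is known only on U; off U the factor X_p φ_j vanishes, which is why `sum_identity`
    -- assumes the relation only after multiplication by D.
    by_cases hx : x ∈ U
    · rw [hA x hx k j]
    · rw [(hh p).opS_comp_apply, (X p).apply_eq_zero
        ((t.mem_or_eventuallyEq_zero j x).resolve_left hx), mul_zero, mul_zero]
  · exact Bounded.lam_sum fun p _ => Bounded.lam_sum fun l _ =>
      ((ha l).lam_mulS hε hε' _).lam_mulS hε hε' _
  · have e : ∀ t : TestTuple Ω Y U, Subelliptic.mulS α (t.pair b)
        = ∑ j, Subelliptic.mulS (b j) (Subelliptic.mulS α (t.comp j)) := by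
      intro t
      rw [TestTuple.pair, mulS_sum]
      refine Finset.sum_congr rfl fun j _ => ?_
      ext x; simp only [mulS_apply]; ring
    simp only [e]
    exact Bounded.lam_sum fun j _ => (hα j).lam_mulS hε hε' _
  · simp only [TestTuple.pair, adjS_sum]
    exact Bounded.sum fun j _ => Bounded.adjS_mulS _ _ _ _ (Bounded.comp hΩ hUΩ j)
      (Bounded.adjS_comp hΩ hU hUΩ (hh i.1) j (hX i.1 j))

/-- Only the germ at 0 matters: test functions supported where a and b agree do not distinguish
them. -/
theorem IsVectorMultiplier.congr {ε : ℝ} {a b : Fin q → Space m → ℂ}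
    (h : IsVectorMultiplier Ω Y ε a) (hab : ∀ᶠ x in nhds 0, ∀ ν, a ν x = b ν x) :
    IsVectorMultiplier Ω Y ε b := by
  obtain ⟨U, hU, h0, hUΩ, hs, C, hC, hest⟩ := h
  obtain ⟨V, hV, hVo, h0V⟩ := eventually_nhds_iff.1 hab
  refine ⟨U ∩ V, hU.inter hVo, ⟨h0, h0V⟩, Set.inter_subset_left.trans hUΩ, fun ν =>
    ((hs ν).mono Set.inter_subset_left).congr fun x hx => (hV x hx.2 ν).symm, C, hC,
    fun φ hφ => ?_⟩
  have e : (fun x => ∑ ν, b ν x * φ ν x) = fun x => ∑ ν, a ν x * φ ν x := by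
    ext x
    refine Finset.sum_congr rfl fun ν _ => ?_
    by_cases hx : x ∈ V
    · rw [hV x hx ν]
    · rw [image_eq_zero_of_notMem_tsupport fun h => hx ((hφ ν).2.2 h).2, mul_zero, mul_zero]
  simp only [e]
  exact hest φ fun ν => ⟨(hφ ν).1, (hφ ν).2.1, (hφ ν).2.2.trans Set.inter_subset_left⟩

/-- The general procedure. -/
theorem IsMatrixMultiplier.isVectorMultiplier_apply (hΩ : IsOpen Ω) (h0 : 0 ∈ Ω)
    {X : Fin q → FirstOrderOp Ω} (hX : ∀ j ν, Estimable Ω Y Ω (fun φ => (X j).adjoint (φ ν)))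
    {Γ : Fin q → Fin q → Space m → ℂ} (hΓ : ∀ k l, ContDiffOn ℝ ∞ (Γ k l) Ω)
    (hΓX : Estimable Ω Y Ω (fun φ x => ∑ k, ∑ l, Γ k l x * (X k).apply (φ l) x))
    {ε₁ ε₂ : ℝ} (hε₁ : 0 < ε₁) (hε₁' : ε₁ ≤ 1) (hε₂ : 0 < ε₂) (hε₂' : ε₂ ≤ 1)
    {a A : Space m → Matrix (Fin q) (Fin q) ℂ} {α : Space m → ℂ}
    (ha : IsMatrixMultiplier Ω Y ε₁ a) (hα : IsScalarMultiplier Ω Y ε₂ α)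
    (hA : ∀ j k, SmoothGerm (fun x => A x j k))
    (hAa : ∀ᶠ x in nhds 0, A x * a x = α x • (1 : Matrix (Fin q) (Fin q) ℂ)) :
    IsVectorMultiplier Ω Y (min ε₁ ε₂ / 2) (fun j x =>
      ∑ p, ∑ l, ∑ k, Γ p k x * A x k l * (X p).apply (fun y => a y l j) x) := by
  choose Ua hUa h0a hUaΩ hsa hesta using ha
  obtain ⟨Uα, hUα, h0α, hUαΩ, hsα, hestα⟩ := hα
  choose UA hUA h0A hsA using hA
  obtain ⟨V, hV, hVo, h0V⟩ := eventually_nhds_iff.1 hAa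
  -- A common neighborhood for all coefficients and the relation A a = α I; the cutoffs then share
  -- one ball inside W.
  let W : Set (Space m) := Ω ∩ (⋂ l, Ua l) ∩ Uα ∩ (⋂ j, ⋂ k, UA j k) ∩ V
  have hWo : IsOpen W := (((hΩ.inter (isOpen_iInter_of_finite hUa)).inter hUα).inter
    (isOpen_iInter_of_finite fun j => isOpen_iInter_of_finite fun k => hUA j k)).inter hVo
  have h0W : (0 : Space m) ∈ W := ⟨⟨⟨⟨h0, Set.mem_iInter.2 h0a⟩, h0α⟩,
    Set.mem_iInter.2 fun j => Set.mem_iInter.2 fun k => h0A j k⟩, h0V⟩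
  have hWΩ : W ⊆ Ω := fun x hx => hx.1.1.1.1
  have hWa : ∀ l, W ⊆ Ua l := fun l x hx => Set.mem_iInter.1 hx.1.1.1.2 l
  have hWα : W ⊆ Uα := fun x hx => hx.1.1.2
  have hWA : ∀ j k, W ⊆ UA j k := fun j k x hx =>
    Set.mem_iInter.1 (Set.mem_iInter.1 hx.1.2 j) k
  have hWV : W ⊆ V := fun x hx => hx.2
  obtain ⟨r, hr, hrW, hcut⟩ := exists_schwartz_cutoff hWo h0W
  have hUΩ : Metric.ball 0 r ⊆ Ω := hrW.trans hWΩ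
  obtain ⟨χ, hχ, hχU⟩ := hcut (fun _ => 1) contDiffOn_const
  choose h _ hh using fun p i => hcut _ (((X p).smooth_ξ i).mono hWΩ)
  choose h₀ _ hh₀ using fun p => hcut _ ((X p).smooth_ζ.mono hWΩ)
  choose G _ hG using fun k l => hcut _ ((hΓ k l).mono hWΩ)
  choose aS _ haS using fun l j => hcut _ ((hsa l j).mono (hWa l))
  choose AS _ hAS using fun k l => hcut _ ((hsA k l).mono (hWA k l))
  obtain ⟨αS, -, hαS⟩ := hcut _ (hsα.mono hWα)
  have hcoef : ∀ p, CoeffEqOn (X p) (Metric.ball 0 r) (h p) (h₀ p) := fun p =>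
    ⟨fun i x hx => hh p i x hx, fun x hx => hh₀ p x hx⟩
  have hχΩ : ∀ x ∉ Ω, χ x = 0 := fun x hx => hχ x fun h => hx (hWΩ h)
  set ε := min ε₁ ε₂
  have hε : 0 ≤ ε := (lt_min hε₁ hε₂).le
  have hε' : ε ≤ 1 := (min_le_left _ _).trans hε₁'
  have hbd := Bounded.lam_half_pair (Y := Y) (U := Metric.ball 0 r) hΩ.measurableSet
    Metric.isOpen_ball hUΩ hX hΓX hcoef hG (a := aS) (A := AS) (α := αS)
    (fun x hx k j => by
      have := congrFun (congrFun (hV x (hWV (hrW hx))) k) j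
      simp only [Matrix.mul_apply, Matrix.smul_apply, Matrix.one_apply, smul_eq_mul] at this
      rw [hαS x hx, ← this]
      exact Finset.sum_congr rfl fun l _ => by rw [hAS k l x hx, haS l j x hx])
    hε hε'
    (fun l => (Bounded.lam_pair hΩ.measurableSet hUΩ (hrW.trans (hWa l)) hε₁.le hε₁' (hesta l)
      (haS l) hχΩ hχU).lam_mono (min_le_left _ _))
    (fun ν => (Bounded.lam_mulS_comp hΩ.measurableSet hUΩ (hrW.trans hWα) hε₂.le hε₂' (hestα ν)
      hαS hχΩ hχU).lam_mono (min_le_right _ _))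
  have hb : ∀ j, ∀ x ∈ Metric.ball (0 : Space m) r,
      (∑ p, ∑ l, ∑ k, mulS (mulS (G p k) (AS k l)) (opS (h p) (h₀ p) (aS l j))) x
        = ∑ p, ∑ l, ∑ k, Γ p k x * A x k l * (X p).apply (fun y => a y l j) x := by
    intro j x hx
    simp only [sum_apply', mulS_apply]
    refine Finset.sum_congr rfl fun p _ => Finset.sum_congr rfl fun l _ =>
      Finset.sum_congr rfl fun k _ => ?_
    rw [hG p k x hx, hAS k l x hx, (hcoef p).opS_eq hx (f := fun y => a y l j)]
    filter_upwards [Metric.isOpen_ball.mem_nhds hx] with y hy using haS l j y hy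
  refine ⟨Metric.ball 0 r, Metric.isOpen_ball, Metric.mem_ball_self hr, hUΩ, fun j => ?_,
    hbd.estimable fun t => ?_⟩
  · exact ((SchwartzMap.smooth _ ⊤).contDiffOn).congr fun x hx => (hb j x hx).symm
  · rw [coe_lam, t.coe_pair hb]

/-! ### Determinants, adjugates and scalar matrices -/

/-- If `A a = α` with `A` smooth, then `α` is a scalar multiplier of the same order as `a`. -/
theorem IsMatrixMultiplier.isScalarMultiplier (hΩ : IsOpen Ω) (h0 : 0 ∈ Ω) {ε : ℝ} (hε : 0 < ε)
    (hε' : ε ≤ 1) {a A : Space m → Matrix (Fin q) (Fin q) ℂ} {α : Space m → ℂ}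
    (ha : IsMatrixMultiplier Ω Y ε a) (hα : SmoothGerm α)
    (hA : ∀ j k, SmoothGerm (fun x => A x j k))
    (hAa : ∀ᶠ x in nhds 0, A x * a x = α x • (1 : Matrix (Fin q) (Fin q) ℂ)) :
    IsScalarMultiplier Ω Y ε α := by
  choose Ua hUa h0a hUaΩ hsa hesta using ha
  obtain ⟨Uα, hUα, h0α, hsα⟩ := hα
  choose UA hUA h0A hsA using hA
  obtain ⟨V, hV, hVo, h0V⟩ := eventually_nhds_iff.1 hAa
  let W : Set (Space m) := Ω ∩ (⋂ l, Ua l) ∩ Uα ∩ (⋂ j, ⋂ k, UA j k) ∩ V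
  have hWo : IsOpen W := (((hΩ.inter (isOpen_iInter_of_finite hUa)).inter hUα).inter
    (isOpen_iInter_of_finite fun j => isOpen_iInter_of_finite fun k => hUA j k)).inter hVo
  have h0W : (0 : Space m) ∈ W := ⟨⟨⟨⟨h0, Set.mem_iInter.2 h0a⟩, h0α⟩,
    Set.mem_iInter.2 fun j => Set.mem_iInter.2 fun k => h0A j k⟩, h0V⟩
  have hWΩ : W ⊆ Ω := fun x hx => hx.1.1.1.1
  have hWa : ∀ l, W ⊆ Ua l := fun l x hx => Set.mem_iInter.1 hx.1.1.1.2 l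
  have hWα : W ⊆ Uα := fun x hx => hx.1.1.2
  have hWA : ∀ j k, W ⊆ UA j k := fun j k x hx =>
    Set.mem_iInter.1 (Set.mem_iInter.1 hx.1.2 j) k
  have hWV : W ⊆ V := fun x hx => hx.2
  obtain ⟨r, hr, hrW, hcut⟩ := exists_schwartz_cutoff hWo h0W
  have hUΩ : Metric.ball 0 r ⊆ Ω := hrW.trans hWΩ
  obtain ⟨χ, hχ, hχU⟩ := hcut (fun _ => 1) contDiffOn_const
  choose aS _ haS using fun l j => hcut _ ((hsa l j).mono (hWa l))
  choose AS _ hAS using fun k l => hcut _ ((hsA k l).mono (hWA k l))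
  have hχΩ : ∀ x ∉ Ω, χ x = 0 := fun x hx => hχ x fun h => hx (hWΩ h)
  refine ⟨Metric.ball 0 r, Metric.isOpen_ball, Metric.mem_ball_self hr, hUΩ,
    hsα.mono (hrW.trans hWα), fun ν => ?_⟩
  -- α φ_ν = ∑_l A_νl ∑_j a_lj φ_j, and smooth factors preserve bounds for Λ^ε.
  have hbd : Bounded TestTuple.size (fun t : TestTuple Ω Y (Metric.ball 0 r) =>
      lam ε (∑ l, mulS (AS ν l) (t.pair (aS l)))) :=
    Bounded.lam_sum fun l _ => (Bounded.lam_pair hΩ.measurableSet hUΩ (hrW.trans (hWa l)) hε.le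
      hε' (hesta l) (haS l) hχΩ hχU).lam_mulS hε.le hε' _
  refine hbd.estimable fun t => ?_
  rw [coe_lam]
  congr 1
  ext x
  rw [sum_apply']
  simp only [mulS_apply, TestTuple.pair, sum_apply']
  by_cases hx : x ∈ Metric.ball (0 : Space m) r
  · have h1 : ∀ j, ∑ l, A x ν l * a x l j = α x * (if ν = j then 1 else 0) := fun j => by
      have := congrFun (congrFun (hV x (hWV (hrW hx))) ν) j
      simpa only [Matrix.mul_apply, Matrix.smul_apply, Matrix.one_apply, smul_eq_mul] using this
    calc ∑ l, AS ν l x * ∑ j, aS l j x * t.comp j x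
        = ∑ j, (∑ l, A x ν l * a x l j) * t.comp j x := by
          simp only [Finset.mul_sum, Finset.sum_mul]
          rw [Finset.sum_comm]
          refine Finset.sum_congr rfl fun j _ => Finset.sum_congr rfl fun l _ => ?_
          rw [hAS ν l x hx, haS l j x hx, mul_assoc]
      _ = α x * t.1 ν x := by
          simp only [h1]
          rw [Finset.sum_eq_single ν (fun j _ hj => by simp [hj.symm]) (by simp)]
          simp [t.coe_comp]
  · have h1 : ∀ j, t.comp j x = 0 := fun j => t.comp_apply_eq_zero j hx
    rw [← t.coe_comp, h1 ν]
    simp [h1]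

theorem IsMatrixMultiplier.smoothGerm {ε : ℝ} {a : Space m → Matrix (Fin q) (Fin q) ℂ}
    (ha : IsMatrixMultiplier Ω Y ε a) (l j : Fin q) : SmoothGerm (fun x => a x l j) := by
  obtain ⟨U, hU, h0, -, hs, -⟩ := ha l
  exact ⟨U, hU, h0, hs j⟩

theorem SmoothGerm.det {M : Space m → Matrix (Fin q) (Fin q) ℂ}
    (hM : ∀ j k, SmoothGerm (fun x => M x j k)) : SmoothGerm (fun x => (M x).det) := by
  choose U hU h0 hs using hM
  refine ⟨⋂ j, ⋂ k, U j k,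
    isOpen_iInter_of_finite fun j => isOpen_iInter_of_finite fun k => hU j k,
    Set.mem_iInter.2 fun j => Set.mem_iInter.2 fun k => h0 j k, ?_⟩
  simp only [Matrix.det_apply']
  refine ContDiffOn.sum fun σ _ => contDiffOn_const.mul (contDiffOn_prod fun i _ => ?_)
  exact (hs (σ i) i).mono ((Set.iInter_subset _ _).trans (Set.iInter_subset _ _))

theorem SmoothGerm.adjugate {M : Space m → Matrix (Fin q) (Fin q) ℂ}
    (hM : ∀ j k, SmoothGerm (fun x => M x j k)) (i j : Fin q) :
    SmoothGerm (fun x => (M x).adjugate i j) := by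
  simp only [Matrix.adjugate_apply]
  refine SmoothGerm.det fun k l => ?_
  by_cases hk : k = j
  · subst hk
    simp only [Matrix.updateRow_self]
    exact ⟨Set.univ, isOpen_univ, trivial, contDiffOn_const⟩
  · simp only [Matrix.updateRow_ne hk]
    exact hM k l

/-- A scalar multiplier `α` gives the matrix multiplier `α I`. -/
theorem IsScalarMultiplier.isMatrixMultiplier {ε : ℝ} {α : Space m → ℂ}
    (hα : IsScalarMultiplier Ω Y ε α) :
    IsMatrixMultiplier Ω Y ε (fun x => α x • (1 : Matrix (Fin q) (Fin q) ℂ)) := by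
  obtain ⟨U, hU, h0, hUΩ, hs, hest⟩ := hα
  intro j
  refine ⟨U, hU, h0, hUΩ, fun k => ?_, ?_⟩
  · simp only [Matrix.smul_apply, smul_eq_mul]
    exact hs.mul contDiffOn_const
  · have e : ∀ (φ : Fin q → Space m → ℂ) x,
        ∑ ν, (α x • (1 : Matrix (Fin q) (Fin q) ℂ)) j ν * φ ν x = α x * φ j x := by
      intro φ x
      simp [Matrix.one_apply]
    simp only [e]
    exact hest j

end Subelliptic

end

/-! ### The theorem and its special cases -/

theorem mainTheorem1 {m q N : ℕ} (hq : 2 ≤ q)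
    (Ω : Set (Subelliptic.Space m)) (hΩ : IsOpen Ω) (h0 : 0 ∈ Ω)
    (Y : Fin N → Fin q → Subelliptic.DiffOp Ω)
    (X : Fin q → Subelliptic.FirstOrderOp Ω)
    (hX : ∀ j ν, Subelliptic.Estimable Ω Y Ω (fun φ => (X j).adjoint (φ ν)))
    (Γ : Fin q → Fin q → Subelliptic.Space m → ℂ)
    (hΓ : ∀ k l, ContDiffOn ℝ ∞ (Γ k l) Ω)
    (hΓX : Subelliptic.Estimable Ω Y Ω
      (fun φ x => ∑ k, ∑ l, Γ k l x * (X k).apply (φ l) x))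
    (ε₁ ε₂ : ℝ) (hε₁ : 0 < ε₁) (hε₁' : ε₁ ≤ 1) (hε₂ : 0 < ε₂) (hε₂' : ε₂ ≤ 1) :
    -- the general procedure
    (∀ (a A : Subelliptic.Space m → Matrix (Fin q) (Fin q) ℂ) (α : Subelliptic.Space m → ℂ),
      Subelliptic.IsMatrixMultiplier Ω Y ε₁ a →
      Subelliptic.IsScalarMultiplier Ω Y ε₂ α →
      (∀ j k, Subelliptic.SmoothGerm (fun x => A x j k)) →
      (∀ᶠ x in nhds 0, A x * a x = α x • (1 : Matrix (Fin q) (Fin q) ℂ)) →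
      Subelliptic.IsVectorMultiplier Ω Y (min ε₁ ε₂ / 2) (fun j x =>
        ∑ p, ∑ l, ∑ k, Γ p k x * A x k l * (X p).apply (fun y => a y l j) x)) ∧
    -- special case (i), with the adjugate matrix of `a`
    (∀ a : Subelliptic.Space m → Matrix (Fin q) (Fin q) ℂ,
      Subelliptic.IsMatrixMultiplier Ω Y ε₁ a →
      Subelliptic.IsVectorMultiplier Ω Y (ε₁ / 2) (fun j x =>
        ∑ p, ∑ l, ∑ k, Γ p k x * (a x).adjugate k l * (X p).apply (fun y => a y l j) x)) ∧
    -- the form of special case (i) when `Γ` is the identity matrix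
    ((∀ k l, ∀ x ∈ Ω, Γ k l x = if k = l then 1 else 0) →
      ∀ a : Subelliptic.Space m → Matrix (Fin q) (Fin q) ℂ,
      Subelliptic.IsMatrixMultiplier Ω Y ε₁ a →
      Subelliptic.IsVectorMultiplier Ω Y (ε₁ / 2) (fun j x =>
        ∑ p, ∑ l, (a x).adjugate p l * (X p).apply (fun y => a y l j) x)) ∧
    -- special case (ii)
    (∀ α : Subelliptic.Space m → ℂ,
      Subelliptic.IsScalarMultiplier Ω Y ε₂ α →
      Subelliptic.IsVectorMultiplier Ω Y (ε₂ / 2) (fun j x =>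
        ∑ k, Γ k j x * (X k).apply α x)) := by
  have hadj : ∀ a : Subelliptic.Space m → Matrix (Fin q) (Fin q) ℂ,
      Subelliptic.IsMatrixMultiplier Ω Y ε₁ a →
      Subelliptic.IsVectorMultiplier Ω Y (ε₁ / 2) (fun j x =>
        ∑ p, ∑ l, ∑ k, Γ p k x * (a x).adjugate k l * (X p).apply (fun y => a y l j) x) := by
    intro a ha
    have hdet : ∀ᶠ x in nhds (0 : Subelliptic.Space m),
        (a x).adjugate * a x = (a x).det • (1 : Matrix (Fin q) (Fin q) ℂ) :=
      Filter.Eventually.of_forall fun x => (a x).adjugate_mul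
    have hsm := Subelliptic.SmoothGerm.adjugate ha.smoothGerm
    -- det a is a scalar multiplier of the same order ε₁, so the minimum of the two orders is ε₁.
    have := ha.isVectorMultiplier_apply hΩ h0 hX hΓ hΓX hε₁ hε₁' hε₁ hε₁'
      (ha.isScalarMultiplier hΩ h0 hε₁ hε₁' (Subelliptic.SmoothGerm.det ha.smoothGerm) hsm hdet)
      hsm hdet
    rwa [min_self] at this
  refine ⟨fun a A α ha hα hA hAa =>
    ha.isVectorMultiplier_apply hΩ h0 hX hΓ hΓX hε₁ hε₁' hε₂ hε₂' hα hA hAa, hadj,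
    fun hΓ1 a ha => (hadj a ha).congr ?_, fun α hα => ?_⟩
  · filter_upwards [hΩ.mem_nhds h0] with x hx j
    refine Finset.sum_congr rfl fun p _ => Finset.sum_congr rfl fun l _ => ?_
    rw [Finset.sum_eq_single p (fun k _ hk => by simp [hΓ1 p k x hx, hk.symm]) (by simp)]
    simp [hΓ1 p p x hx]
  -- With a = α I and A = I, only the terms l = j and k = j survive.
  · have := hα.isMatrixMultiplier.isVectorMultiplier_apply hΩ h0 hX hΓ hΓX hε₂ hε₂' hε₂ hε₂'
      (A := fun _ => 1) hα (fun j k => ⟨Set.univ, isOpen_univ, trivial, contDiffOn_const⟩)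
      (Filter.Eventually.of_forall fun x => one_mul _)
    rw [min_self] at this
    refine this.congr (Filter.Eventually.of_forall fun x j => ?_)
    refine Finset.sum_congr rfl fun p _ => ?_
    have hz : ∀ l, l ≠ j → (X p).apply
        (fun y => (α y • (1 : Matrix (Fin q) (Fin q) ℂ)) l j) x = 0 := fun l hl =>
      (X p).apply_eq_zero (Filter.Eventually.of_forall fun y => by simp [hl])
    rw [Finset.sum_eq_single j (fun l _ hl => by
        simp only [hz l hl, mul_zero, Finset.sum_const_zero]) (by simp),
      Finset.sum_eq_single j (fun k _ hk => by simp [hk]) (by simp)]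
    simp
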